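/- **Conventions.** A visibly pushdown alphabet is a finite alphabet $\Sigma=\Sigma_{call}\uplus\Sigma_{int}\uplus\Sigma_{ret}$. The set $\Sigma^\triangle$ of well-matched words is the smallest set containing $\varepsilon$ and every $c\in\Sigma_{int}$ that is closed under concatenation and under $w\mapsto awb$ for $a\in\Sigma_{call}$, $b\in\Sigma_{ret}$. A deterministic visibly pushdown automaton (DVPA) $A$ has a finite state set, a finite stack alphabet with a bottom symbol $\bot$, pushes one symbol different from $\bot$ on a call letter, pops the topmost symbol on a return letter, leaves the stack unchanged on an internal letter (the next state and the pushed symbol depend on the state, the letter and the topmost stack symbol), and is stuck on the empty stack; $L(A)\subseteq\Sigma^\triangle$ is the set of words leading from the initial state with stack $\bot$ to a final state with stack $\bot$. An Ext-algebra $(R,O)$ is a monoid $R$ together with a monoid $O$ of maps $R\to R$ under composition that contains all left and right multiplications of $R$. For $u,v\in\Sigma^*$ with $uv\in\Sigma^\triangle$ let $\mathrm{ext}_{u,v}\colon\Sigma^\triangle\to\Sigma^\triangle$, $x\mapsto uxv$; the set $\mathcal O(\Sigma^\triangle)$ of all these maps makes $(\Sigma^\triangle,\mathcal O(\Sigma^\triangle))$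 an Ext-algebra. Put $\mathcal O(\Sigma^\triangle)^{k,l}=\{\mathrm{ext}_{u,v}: uv\in\Sigma^\triangle,\ |u|=k,\ |v|=l\}$. For $L\subseteq\Sigma^\triangle$ let $x\sim_L y$ if $e(x)\in L\Leftrightarrow e(y)\in L$ for all $e\in\mathcal O(\Sigma^\triangle)$. The syntactic Ext-algebra of $L$ is $(R_L,O_L)$ with $R_L=\Sigma^\triangle/{\sim_L}$ and $O_L$ the set of maps on $R_L$ induced by elements of $\mathcal O(\Sigma^\triangle)$, and the syntactic morphism $(\varphi_L,\psi_L)$ is given by $\varphi_L(x)=[x]$ and $\psi_L(e)([x])=[e(x)]$. It is quasi-aperiodic if for all $k,l\in\mathbb N$ every semigroup contained in $\psi_L(\mathcal O(\Sigma^\triangle)^{k,l})$ is aperiodic, i.e. contains no non-trivial group. Let $\mathrm{MOD}_m=\{w\in\{0,1\}^*: m \text{ divides } |w|_1\}$. Every language over a finite alphabet is regarded as a binary language via a fixed injective encoding of letters by blocks of bits of one fixed positive length. For binary languages, $K\le_{cd}L$ means that there are a polynomial $p$, a constant $d$ and circuits $(C_n)_{n\in\mathbb N}$ deciding $K$, where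 $C_n$ has $n$ inputs, depth at most $d$ and size at most $p(n)$, its input gates are literals $x_i,\neg x_i$, and its other gates are AND gates, OR gates (of unbounded fan-in) and oracle gates deciding $L\cap\{0,1\}^{j}$ with $j\le p(n)$, such that no path leads from the output of an oracle gate to an input of an oracle gate. **Proposition.** There is an algorithm that, given a DVPA $A$ such that the syntactic morphism of $L=L(A)$ is not quasi-aperiodic, halts and outputs an integer $m\ge 2$ such that $\mathrm{MOD}_m\le_{cd}L$, for every choice of the binary encoding of the alphabet of $A$. -/

import Mathlib

/-! ### Visibly pushdown alphabets and well-matched words -/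

/-- The letters of the visibly pushdown alphabet whose call, internal and return letters are the
elements of `C`, `I` and `R`; the three parts are disjoint by construction. -/
inductive Letter (C I R : Type) : Type
  | call (a : C) : Letter C I R
  | int (c : I) : Letter C I R
  | ret (b : R) : Letter C I R

/-- Well-matched words. -/
inductive WellMatched {C I R : Type} : List (Letter C I R) → Prop
  | nil : WellMatched []
  | int (c : I) : WellMatched [Letter.int c]
  | wrap (a : C) (b : R) {w : List (Letter C I R)} (hw : WellMatched w) :
      WellMatched (Letter.call a :: (w ++ [Letter.ret b]))
  | append {u v : List (Letter C I R)} (hu : WellMatched u) (hv : WellMatched v) :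
      WellMatched (u ++ v)

/-- Inserting a well-matched word into a context yields a well-matched word. -/
theorem WellMatched.insert {C I R : Type} {w x : List (Letter C I R)} (hw : WellMatched w)
    (hx : WellMatched x) :
    ∀ u v : List (Letter C I R), u ++ v = w → WellMatched (u ++ x ++ v) := by
  induction hw with
  | nil =>
    intro u v h
    obtain ⟨rfl, rfl⟩ := List.append_eq_nil_iff.mp h
    simpa using hx
  | int c =>
    intro u v h
    rcases List.append_eq_singleton_iff.mp h with ⟨rfl, rfl⟩ | ⟨rfl, rfl⟩
    · simpa using hx.append (WellMatched.int c)
    · simpa using (WellMatched.int c).append hx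
  | @wrap a b w hw ih =>
    intro u v h
    rcases u with _ | ⟨d, u'⟩
    · simp only [List.nil_append] at h
      subst h
      simpa using hx.append (WellMatched.wrap a b hw)
    · simp only [List.cons_append, List.cons.injEq] at h
      obtain ⟨rfl, h⟩ := h
      rcases List.eq_nil_or_concat v with rfl | ⟨v', d, rfl⟩
      · simp only [List.append_nil] at h
        subst h
        simpa using (WellMatched.wrap a b hw).append hx
      · rw [List.concat_eq_append, ← List.append_assoc] at h
        obtain ⟨h1, h2⟩ := List.append_inj' h rfl
        simp only [List.cons.injEq, and_true] at h2
        subst h2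
        simpa using WellMatched.wrap a b (ih u' v' h1)
  | @append w₁ w₂ h₁ h₂ ih₁ ih₂ =>
    intro u v h
    rcases List.append_eq_append_iff.mp h with ⟨t, rfl, rfl⟩ | ⟨t, rfl, rfl⟩
    · simpa using (ih₁ u t rfl).append h₂
    · simpa using h₁.append (ih₂ t v rfl)

/-- The type of well-matched words, a monoid under concatenation. -/
def WMWord (C I R : Type) : Type := {w : List (Letter C I R) // WellMatched w}

instance (C I R : Type) : Monoid (WMWord C I R) where
  one := ⟨[], WellMatched.nil⟩
  mul u v := ⟨u.1 ++ v.1, u.2.append v.2⟩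
  mul_assoc u v w := Subtype.ext (List.append_assoc u.1 v.1 w.1)
  one_mul u := Subtype.ext (List.nil_append u.1)
  mul_one u := Subtype.ext (List.append_nil u.1)

/-! ### Deterministic visibly pushdown automata -/

/-- Deterministic visibly pushdown automata. The transition function is split by the kind of the
letter read: in state `q` with topmost stack symbol `α`, a call letter pushes a symbol different
from the bottom symbol onto `α`, an internal letter leaves the stack as it is, and a return letter
pops `α`. -/
structure DVPA (Q C I R Γ : Type) where
  start : Q
  final : Finset Q
  bot : Γ
  onCall : Q → C → Γ → Q × {γ : Γ // γ ≠ bot}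
  onInt : Q → I → Γ → Q
  onRet : Q → R → Γ → Q

namespace DVPA

/-- The extended transition function (state, input word, stack with its top first); the automaton
is stuck on the empty stack. -/
def run {Q C I R Γ : Type} (A : DVPA Q C I R Γ) : Q → List (Letter C I R) → List Γ → Q × List Γ
  | q, [], β => (q, β)
  | q, _ :: _, [] => (q, [])
  | q, Letter.call a :: w, α :: β =>
      A.run (A.onCall q a α).1 w ((A.onCall q a α).2.1 :: α :: β)
  | q, Letter.int c :: w, α :: β => A.run (A.onInt q c α) w (α :: β)
  | q, Letter.ret b :: w, α :: β => A.run (A.onRet q b α) w β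

/-- The accepted language: acceptance in a final state with the stack consisting of the bottom
symbol only. -/
def language {Q C I R Γ : Type} (A : DVPA Q C I R Γ) : Language (Letter C I R) :=
  {w | (A.run A.start w [A.bot]).1 ∈ A.final ∧ (A.run A.start w [A.bot]).2 = [A.bot]}

end DVPA

/-- The data type of descriptions of automata: the numbers of states, call letters, internal
letters, return letters and stack symbols; the initial state and the bottom symbol; the
characteristic list of the set of final states; the three transition tables. -/
abbrev DVPACode : Type :=
  (ℕ × ℕ × ℕ × ℕ × ℕ) × (ℕ × ℕ) × List Bool ×
    List (List (List (ℕ × ℕ))) × List (List (List ℕ)) × List (List (List ℕ))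

/-- The description of an automaton whose states, letters and stack symbols are numbered. -/
def DVPA.code {q c i r g : ℕ} (A : DVPA (Fin q) (Fin c) (Fin i) (Fin r) (Fin g)) : DVPACode :=
  ((q, c, i, r, g), ((A.start : ℕ), (A.bot : ℕ)), List.ofFn (fun s => decide (s ∈ A.final)),
    List.ofFn (fun s => List.ofFn fun a => List.ofFn fun α =>
      (((A.onCall s a α).1 : ℕ), ((A.onCall s a α).2.1 : ℕ))),
    List.ofFn (fun s => List.ofFn fun a => List.ofFn fun α => ((A.onInt s a α : Fin q) : ℕ)),
    List.ofFn (fun s => List.ofFn fun a => List.ofFn fun α => ((A.onRet s a α : Fin q) : ℕ)))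

/-! ### Ext-algebras -/

/-- An Ext-algebra on the monoid `M`: a submonoid of the monoid of all maps `M → M` under
composition that contains all left and right multiplications. -/
structure ExtAlgebra (M : Type) [Monoid M] where
  ops : Submonoid (Function.End M)
  left_mem : ∀ r : M, (fun x => r * x) ∈ ops
  right_mem : ∀ r : M, (fun x => x * r) ∈ ops

/-- Morphisms of Ext-algebras. -/
structure ExtHom {M N : Type} [Monoid M] [Monoid N] (A : ExtAlgebra M) (B : ExtAlgebra N) where
  φ : M →* N
  ψ : A.ops →* B.ops
  map_apply : ∀ (e : A.ops) (r : M), (ψ e).1 (φ r) = φ (e.1 r)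
  map_left : ∀ r : M, ψ ⟨fun x => r * x, A.left_mem r⟩ = ⟨fun x => φ r * x, B.left_mem (φ r)⟩
  map_right : ∀ r : M, ψ ⟨fun x => x * r, A.right_mem r⟩ = ⟨fun x => x * φ r, B.right_mem (φ r)⟩

/-- Congruences on an Ext-algebra. -/
structure ExtCon {M : Type} [Monoid M] (A : ExtAlgebra M) extends Setoid M where
  map : ∀ e ∈ A.ops, ∀ x y : M, r x y → r (e x) (e y)

namespace ExtCon

/-- A congruence on an Ext-algebra is a congruence on the underlying monoid. -/
def toCon {M : Type} [Monoid M] {A : ExtAlgebra M} (c : ExtCon A) : Con M where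
  toSetoid := c.toSetoid
  mul' {w x y z} h₁ h₂ :=
    c.toSetoid.trans' (c.map _ (A.right_mem y) w x h₁) (c.map _ (A.left_mem x) y z h₂)

/-- The map on classes that is induced by an operation of the Ext-algebra. -/
def induced {M : Type} [Monoid M] {A : ExtAlgebra M} (c : ExtCon A) (e : A.ops) :
    Function.End c.toCon.Quotient :=
  Quotient.map' e.1 (fun x y h => c.map e.1 e.2 x y h)

/-- The quotient of an Ext-algebra by a congruence. -/
def quotient {M : Type} [Monoid M] {A : ExtAlgebra M} (c : ExtCon A) :
    ExtAlgebra c.toCon.Quotient where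
  ops :=
    { carrier := {e' | ∃ e ∈ A.ops, ∀ x : M, e' (x : c.toCon.Quotient) = (e x : M)}
      one_mem' := ⟨1, A.ops.one_mem, fun _ => rfl⟩
      mul_mem' := by
        rintro e' f' ⟨e, he, h⟩ ⟨f, hf, k⟩
        refine ⟨e * f, A.ops.mul_mem he hf, fun x => ?_⟩
        change e' (f' x) = _
        rw [k, h]
        rfl }
  left_mem r := by
    induction r using Con.induction_on with
    | H r => exact ⟨fun x => r * x, A.left_mem r, fun _ => rfl⟩
  right_mem r := by
    induction r using Con.induction_on with
    | H r => exact ⟨fun x => x * r, A.right_mem r, fun _ => rfl⟩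

/-- The morphism onto the quotient: `φ r = [r]` and `ψ e [r] = [e r]`. -/
def proj {M : Type} [Monoid M] {A : ExtAlgebra M} (c : ExtCon A) : ExtHom A c.quotient where
  φ := c.toCon.mk'
  ψ :=
    { toFun := fun e => ⟨c.induced e, e.1, e.2, fun _ => rfl⟩
      map_one' := by
        apply Subtype.ext
        funext x
        induction x using Con.induction_on with
        | H x => rfl
      map_mul' := by
        intro e f
        apply Subtype.ext
        funext x
        induction x using Con.induction_on with
        | H x => rfl }
  map_apply _ _ := rfl
  map_left r := by
    apply Subtype.ext
    funext x
    induction x using Con.induction_on with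
    | H x => rfl
  map_right r := by
    apply Subtype.ext
    funext x
    induction x using Con.induction_on with
    | H x => rfl

end ExtCon

/-! ### The free Ext-algebra of well-matched words, syntactic morphisms, quasi-aperiodicity -/

/-- The map `x ↦ u x v` on well-matched words, for a context `(u, v)`. -/
def extMap {C I R : Type} (u v : List (Letter C I R)) (h : WellMatched (u ++ v)) :
    Function.End (WMWord C I R) :=
  fun x => ⟨u ++ x.1 ++ v, h.insert x.2 u v rfl⟩

/-- The Ext-algebra of well-matched words; its operations are the maps `x ↦ u x v`. -/
def freeExt (C I R : Type) : ExtAlgebra (WMWord C I R) where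
  ops :=
    { carrier := {e | ∃ u v, ∃ h : WellMatched (u ++ v), e = extMap u v h}
      one_mem' := by
        refine ⟨[], [], WellMatched.nil, ?_⟩
        funext x
        apply Subtype.ext
        change x.1 = [] ++ x.1 ++ []
        simp
      mul_mem' := by
        rintro _ _ ⟨u, v, h, rfl⟩ ⟨u', v', h', rfl⟩
        refine ⟨u ++ u', v' ++ v, by simpa using h.insert h' u v rfl, ?_⟩
        funext x
        apply Subtype.ext
        change u ++ (u' ++ x.1 ++ v') ++ v = (u ++ u') ++ x.1 ++ (v' ++ v)
        simp }
  left_mem r := by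
    refine ⟨r.1, [], by simpa using r.2, ?_⟩
    funext x
    apply Subtype.ext
    change r.1 ++ x.1 = r.1 ++ x.1 ++ []
    simp
  right_mem r := ⟨[], r.1, by simpa using r.2, rfl⟩

/-- The operations `x ↦ u x v` with `|u| = k` and `|v| = l`. -/
def extMapsOfLength (C I R : Type) (k l : ℕ) : Set (freeExt C I R).ops :=
  {e | ∃ u v, ∃ h : WellMatched (u ++ v), u.length = k ∧ v.length = l ∧ e.1 = extMap u v h}

/-- The syntactic congruence of a language of well-matched words. -/
def syntacticCon {C I R : Type} (L : Language (Letter C I R)) : ExtCon (freeExt C I R) where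
  r x y := ∀ e ∈ (freeExt C I R).ops, ((e x).1 ∈ L ↔ (e y).1 ∈ L)
  iseqv :=
    ⟨fun _ _ _ => Iff.rfl, fun h e he => (h e he).symm, fun h h' e he => (h e he).trans (h' e he)⟩
  map e he _ _ h f hf := h (f * e) ((freeExt C I R).ops.mul_mem hf he)

/-- The syntactic morphism of a language, onto its syntactic Ext-algebra. -/
def syntacticHom {C I R : Type} (L : Language (Letter C I R)) :
    ExtHom (freeExt C I R) (syntacticCon L).quotient :=
  (syntacticCon L).proj

/-- A subsemigroup that is a group; its identity need not be an identity of the semigroup. -/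
def Subsemigroup.IsGroupIn {S : Type} [Semigroup S] (G : Subsemigroup S) : Prop :=
  ∃ e ∈ G, (∀ x ∈ G, e * x = x ∧ x * e = x) ∧ ∀ x ∈ G, ∃ y ∈ G, x * y = e ∧ y * x = e

/-- A semigroup is aperiodic if it contains no non-trivial group. -/
def IsAperiodicSemigroup (S : Type) [Semigroup S] : Prop :=
  ∀ G : Subsemigroup S, G.IsGroupIn → (G : Set S).Subsingleton

/-- A morphism from the Ext-algebra of well-matched words is quasi-aperiodic if, for all `k` and
`l`, every semigroup contained in the image of the operations `x ↦ u x v` with `|u| = k` and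
`|v| = l` is aperiodic. -/
def ExtHom.IsQuasiAperiodic {C I R N : Type} [Monoid N] {B : ExtAlgebra N}
    (h : ExtHom (freeExt C I R) B) : Prop :=
  ∀ k l : ℕ, ∀ T : Subsemigroup B.ops,
    (T : Set B.ops) ⊆ h.ψ '' extMapsOfLength C I R k l → IsAperiodicSemigroup T

/-! ### Constant-depth truth-table reducibility -/

/-- Gate labels in a circuit with `n` inputs: `lit i b` is the literal that is true if and only if
the `i`-th input bit equals `b`. -/
inductive GateLabel (n : ℕ) : Type
  | lit (i : Fin n) (b : Bool) : GateLabel n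
  | and : GateLabel n
  | or : GateLabel n
  | oracle : GateLabel n

open Classical in
/-- The value of a gate on the input `x`, given the list of the values of its predecessors;
oracle gates decide membership in `O`. -/
noncomputable def GateLabel.value {n : ℕ} (O : Language Bool) (x : Fin n → Bool) :
    GateLabel n → List Bool → Bool
  | lit i b, _ => x i == b
  | and, vals => vals.all id
  | or, vals => vals.any id
  | oracle, vals => decide (vals ∈ O)

/-- Circuits with `n` inputs: finite directed acyclic graphs of gates of unbounded fan-in.
`preds g` is the ordered list of the gates whose outputs are fed into `g`. -/
structure OracleCircuit (n : ℕ) where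
  Node : Type
  fintypeNode : Fintype Node
  label : Node → GateLabel n
  preds : Node → List Node
  preds_lit : ∀ g i b, label g = GateLabel.lit i b → preds g = []
  acyclic : WellFounded (fun a b : Node => a ∈ preds b)
  output : Node

namespace OracleCircuit

/-- The number of gates. -/
def size {n : ℕ} (K : OracleCircuit n) : ℕ := @Fintype.card K.Node K.fintypeNode

/-- The value of each gate on the input `x`, with oracle `O`. -/
noncomputable def eval {n : ℕ} (K : OracleCircuit n) (O : Language Bool) (x : Fin n → Bool) :
    K.Node → Bool :=
  K.acyclic.fix fun g ih =>
    (K.label g).value O x ((K.preds g).attach.map fun j => ih j.1 j.2)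

theorem eval_eq {n : ℕ} (K : OracleCircuit n) (O : Language Bool) (x : Fin n → Bool)
    (g : K.Node) :
    K.eval O x g = (K.label g).value O x ((K.preds g).map (K.eval O x)) := by
  unfold eval
  rw [WellFounded.fix_eq]
  simp

/-- The length of a longest path that ends in the given gate. -/
noncomputable def depth {n : ℕ} (K : OracleCircuit n) : K.Node → ℕ :=
  K.acyclic.fix fun g ih => ((K.preds g).attach.map fun j => ih j.1 j.2 + 1).foldr max 0

theorem depth_eq {n : ℕ} (K : OracleCircuit n) (g : K.Node) :
    K.depth g = ((K.preds g).map fun j => K.depth j + 1).foldr max 0 := by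
  unfold depth
  rw [WellFounded.fix_eq]
  simp

/-- There is no path from the output of an oracle gate to an input of an oracle gate. -/
def IsTruthTable {n : ℕ} (K : OracleCircuit n) : Prop :=
  ∀ g h : K.Node, K.label g = GateLabel.oracle → K.label h = GateLabel.oracle →
    ¬ Relation.TransGen (fun a b => a ∈ K.preds b) g h

end OracleCircuit

/-- Constant-depth truth-table reducibility of the binary language `K` to the binary language `L`,
by a family of circuits of constant depth and polynomial size whose input gates are literals and
whose other gates are AND gates, OR gates and oracle gates for `L`. -/
def CdReducible (K L : Language Bool) : Prop :=
  ∃ (p : Polynomial ℕ) (d : ℕ), ∀ n : ℕ, ∃ D : OracleCircuit n,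
    D.size ≤ p.eval n ∧ (∀ g, D.depth g ≤ d) ∧ D.IsTruthTable ∧
    (∀ g, D.label g = GateLabel.oracle → (D.preds g).length ≤ p.eval n) ∧
    ∀ x : Fin n → Bool, D.eval L x D.output = true ↔ List.ofFn x ∈ K

/-- A binary encoding of an alphabet: different letters are encoded by different blocks of bits
of the same positive length. -/
structure BlockEncoding (S : Type) where
  width : ℕ
  width_pos : 0 < width
  block : S → Fin width → Bool
  injective : Function.Injective block

/-- The binary language of all encodings of words of `L`. -/
def BlockEncoding.encode {S : Type} (E : BlockEncoding S) (L : Language S) : Language Bool :=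
  {x | ∃ w ∈ L, x = w.flatMap fun a => List.ofFn (E.block a)}

/-- Binary words in which the number of ones is divisible by `m`. -/
def modLanguage (m : ℕ) : Language Bool := {w | m ∣ w.count true}

/-! If the syntactic morphism is not quasi-aperiodic, some image of the contexts of fixed lengths
`k`, `l` contains a non-trivial group. Its identity and another element `g` are induced by contexts
`(u₀, v₀)` and `(u₁, v₁)`. Read a bit `b` as the context `(u_b, v_b)` and nest these contexts around
a core fixed by the identity. Zeros then act trivially and ones act as `g`, so the syntactic class
of the nested word depends only on the number of ones. There are finitely many behaviours and `g` is
invertible, so the classes are purely periodic in this number. A suitable outer context `(y, z)`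
separates zero ones from one one. Membership in `L` is then a periodic predicate `s` whose least
period `m` is at least 2 (`exists_modWitness`).

A set of residues modulo `m` with no smaller period is mapped into itself by the shift by `k` only
if `m ∣ k` (`dvd_iff_forall_shift`). Hence `MOD_m` is a conjunction of at most `m` queries, one for
each residue `t` with `s t`, in which `t` further ones are inserted at the core. Since both bits use
contexts of equal lengths, every bit of an encoded query is a constant or a literal, so the circuit
has depth 2 (`ModWitness.cdReducible`).

To compute some such `m`, all tuples of words and moduli are searched for a `ModWitness`. The
condition on all bit words is decidable: residue and automaton behaviour are determined recursively
from the tail of the bit word and take finitely many values, so words of bounded length suffice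
(`mem_iff_of_short`). The search terminates because a witness exists, and every witness it can find
is correct. -/

/-! ### Nested contexts -/

/-- The word `u b₁ ⋯ u bₙ x v bₙ ⋯ v b₁` for the bit word `b₁ ⋯ bₙ`. -/
def nest {S : Type} (u v : Bool → List S) (x : List S) (w : List Bool) : List S :=
  w.foldr (fun b X => u b ++ X ++ v b) x

theorem nest_cons {S : Type} (u v : Bool → List S) (x : List S) (b : Bool) (w : List Bool) :
    nest u v x (b :: w) = u b ++ nest u v x w ++ v b := rfl

theorem nest_append {S : Type} (u v : Bool → List S) (x : List S) (w w' : List Bool) :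
    nest u v x (w ++ w') = nest u v (nest u v x w') w := by
  simp [nest]

theorem nest_map {S T : Type} (f : S → T) (u v : Bool → List S) (x : List S) (w : List Bool) :
    (nest u v x w).map f = nest (fun b => (u b).map f) (fun b => (v b).map f) (x.map f) w := by
  induction w with
  | nil => rfl
  | cons b w ih => simp [nest_cons, ih]

theorem WellMatched.nest {C I R : Type} {u v : Bool → List (Letter C I R)}
    {x : List (Letter C I R)} (huv : ∀ b, WellMatched (u b ++ v b)) (hx : WellMatched x)
    (w : List Bool) : WellMatched (nest u v x w) := by
  induction w with
  | nil => exact hx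
  | cons b w ih => exact (huv b).insert ih _ _ rfl

/-! ### Behaviours of well-matched words -/

namespace DVPA

variable {Q C I R Γ : Type} (A : DVPA Q C I R Γ)

theorem run_empty_stack (q : Q) (w : List (Letter C I R)) : A.run q w [] = (q, []) := by
  cases w <;> simp [run]

theorem run_append (q : Q) (u v : List (Letter C I R)) (β : List Γ) :
    A.run q (u ++ v) β = A.run (A.run q u β).1 v (A.run q u β).2 := by
  induction u generalizing q β with
  | nil => simp [run]
  | cons l u ih =>
    cases β with
    | nil => simp [run_empty_stack]
    | cons α β => cases l <;> simp [run, ih]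

/-- The state reached by reading a word, as a function of the state and the topmost stack symbol
at the start. -/
def behaviour (w : List (Letter C I R)) (s : Q × Γ) : Q := (A.run s.1 w [s.2]).1

/-- Everything pushed by a well-matched word is popped again before the symbols below can be
touched, and a step sees only the topmost symbol. This reduces such a word to its behaviour, of
which there are finitely many when states and stack symbols are finite. -/
theorem run_eq_of_wellMatched {w : List (Letter C I R)} (hw : WellMatched w) :
    ∀ (q : Q) (α : Γ) (β : List Γ), A.run q w (α :: β) = (A.behaviour w (q, α), α :: β) := by
  -- The state `q'` must not depend on the stack `β` below `α`.
  suffices h : ∀ (q : Q) (α : Γ), ∃ q', ∀ β, A.run q w (α :: β) = (q', α :: β) by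
    intro q α β
    obtain ⟨q', h⟩ := h q α
    simp [behaviour, h]
  induction hw with
  | nil => exact fun q α => ⟨q, fun β => rfl⟩
  | int c => exact fun q α => ⟨A.onInt q c α, fun β => by simp [run]⟩
  | wrap a b hw ih =>
    intro q α
    obtain ⟨q', h⟩ := ih (A.onCall q a α).1 (A.onCall q a α).2.1
    exact ⟨A.onRet q' b (A.onCall q a α).2.1, fun β => by simp [run, run_append, h]⟩
  | append hu hv ihu ihv =>
    intro q α
    obtain ⟨q', h⟩ := ihu q α
    obtain ⟨q'', h'⟩ := ihv q' α
    exact ⟨q'', fun β => by simp [run_append, h, h']⟩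

/-- If `u` has emptied the stack, the automaton is stuck in both runs; otherwise only the behaviour
of the middle word matters. -/
theorem run_congr_of_behaviour_eq {x x' : List (Letter C I R)} (hx : WellMatched x)
    (hx' : WellMatched x') (h : A.behaviour x = A.behaviour x') (u v : List (Letter C I R)) (q : Q)
    (β : List Γ) : A.run q (u ++ x ++ v) β = A.run q (u ++ x' ++ v) β := by
  simp only [run_append]
  generalize A.run q u β = s
  obtain ⟨q', _ | ⟨α, γ⟩⟩ := s
  · simp [run_empty_stack]
  · simp [A.run_eq_of_wellMatched hx, A.run_eq_of_wellMatched hx', h]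

theorem behaviour_congr {x x' : List (Letter C I R)} (hx : WellMatched x)
    (hx' : WellMatched x') (h : A.behaviour x = A.behaviour x') (u v : List (Letter C I R)) :
    A.behaviour (u ++ x ++ v) = A.behaviour (u ++ x' ++ v) := by
  funext s
  simp only [behaviour, A.run_congr_of_behaviour_eq hx hx' h]

theorem mem_language_congr {x x' : List (Letter C I R)} (hx : WellMatched x)
    (hx' : WellMatched x') (h : A.behaviour x = A.behaviour x') (u v : List (Letter C I R)) :
    u ++ x ++ v ∈ A.language ↔ u ++ x' ++ v ∈ A.language := by
  change (_ ∧ _) ↔ (_ ∧ _)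
  rw [A.run_congr_of_behaviour_eq hx hx' h]

end DVPA

/-- A value of words over a finite set, determined recursively from the tail of the word, is
attained on a short word. -/
theorem exists_short_word_value_eq {B X : Type} [Fintype X] (val : List B → X)
    (h : ∀ b w w', val w = val w' → val (b :: w) = val (b :: w')) (w : List B) :
    ∃ w', w'.length < Fintype.card X ∧ val w' = val w := by
  have happ : ∀ t w w', val w = val w' → val (t ++ w) = val (t ++ w') := by
    intro t w w' e
    induction t with
    | nil => exact e
    | cons b t ih => exact h _ _ _ ih
  induction hn : w.length using Nat.strong_induction_on generalizing w with
  | _ n ih =>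
    by_cases hlt : n < Fintype.card X
    · exact ⟨w, hn ▸ hlt, rfl⟩
    -- Pigeonhole on the `n + 1` suffixes of `w`; the factor between two suffixes of equal value can
    -- be cut out.
    obtain ⟨i, j, hij, e⟩ := Fintype.exists_ne_map_eq_of_card_lt
      (fun i : Fin (n + 1) => val (w.drop i)) (by simp; omega)
    wlog hlt' : i < j generalizing i j
    · exact this j i hij.symm e.symm (lt_of_le_of_ne (not_lt.mp hlt') hij.symm)
    have e' : val (w.take i ++ w.drop j) = val w := by
      rw [happ _ _ _ e.symm, List.take_append_drop]
    obtain ⟨w', hw', e''⟩ := ih (w.take i ++ w.drop j).length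
      (by have : (i : ℕ) < j := hlt'
          simp; omega) _ rfl
    exact ⟨w', hw', e''.trans e'⟩

/-! ### Periodic predicates -/

/-- Take the least positive period `m`. It is not 1 because `s 0` and `s 1` differ. The last clause
is minimality, expressed on residues so that it is a finite test. -/
theorem exists_minimal_period {s : ℕ → Prop} {n : ℕ} (hn : 0 < n) (hs : ∀ c, s (c + n) ↔ s c)
    (h01 : ¬ (s 1 ↔ s 0)) :
    ∃ m, 2 ≤ m ∧ (∀ c, s c ↔ s (c % m)) ∧
      ∀ d, 0 < d → d < m → ∃ c < m, ¬ (s c ↔ s ((c + d) % m)) := by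
  classical
  have hex : ∃ n, 0 < n ∧ ∀ c, s (c + n) ↔ s c := ⟨n, hn, hs⟩
  obtain ⟨m, hm, hmin⟩ : ∃ m, (0 < m ∧ ∀ c, s (c + m) ↔ s c) ∧
      ∀ d < m, ¬ (0 < d ∧ ∀ c, s (c + d) ↔ s c) :=
    ⟨Nat.find hex, Nat.find_spec hex, fun d hd => Nat.find_min hex hd⟩
  obtain ⟨hm0, hm⟩ := hm
  have hmul : ∀ k c, s (c + m * k) ↔ s c := by
    intro k
    induction k with
    | zero => simp
    | succ k ih =>
      intro c
      rw [mul_add, mul_one, ← add_assoc, hm, ih]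
  have hmod : ∀ c, s c ↔ s (c % m) := fun c => by
    conv_lhs => rw [← Nat.mod_add_div c m]
    exact hmul _ _
  refine ⟨m, ?_, hmod, fun d hd0 hdm => ?_⟩
  · by_contra hlt
    obtain rfl : m = 1 := by omega
    exact h01 (hm 0)
  · by_contra! hc
    refine hmin d hdm ⟨hd0, fun c => ?_⟩
    rw [hmod c, hc _ (Nat.mod_lt c hm0), hmod (c + d)]
    simp

/-- An injective self-map of a finite set is onto: if the shift by `k` maps the set of residues
satisfying `s` into itself, it preserves the set, so `k % m` would be a smaller period unless it is
0. -/
theorem dvd_iff_forall_shift {s : ℕ → Prop} {m : ℕ} (hm : 0 < m)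
    (hs : ∀ d, 0 < d → d < m → ∃ c < m, ¬ (s c ↔ s ((c + d) % m))) (k : ℕ) :
    m ∣ k ↔ ∀ t < m, s t → s ((k + t) % m) := by
  constructor
  · rintro ⟨a, rfl⟩ t ht h
    simpa [Nat.mod_eq_of_lt ht] using h
  intro h
  by_contra hk
  have hd0 : 0 < k % m := Nat.pos_of_ne_zero fun h0 => hk (Nat.dvd_of_mod_eq_zero h0)
  obtain ⟨c, hc, hne⟩ := hs (k % m) hd0 (Nat.mod_lt k hm)
  have hiter : ∀ t, s (t % m) → ∀ j, s ((t + j * k) % m) := by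
    intro t ht j
    induction j with
    | zero => simpa using ht
    | succ j ih =>
      have := h _ (Nat.mod_lt _ hm) ih
      rw [Nat.add_mod_mod] at this
      convert this using 2
      ring_nf
  refine hne ⟨fun hsc => ?_, fun hsc => ?_⟩
  · have := hiter c (by rwa [Nat.mod_eq_of_lt hc]) 1
    simpa using this
  -- Shifting `c + k` another `m - 1` times by `k` returns to `c`, since `m * k` vanishes modulo
  -- `m`.
  · have := hiter (c + k % m) hsc (m - 1)
    have e : (c + k % m + (m - 1) * k) % m = c := by
      have : (c % m + k % m + (m - 1) * k) ≡ c [MOD m] := by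
        calc (c % m + k % m + (m - 1) * k) ≡ c + k + (m - 1) * k [MOD m] :=
              ((Nat.mod_modEq _ _).add (Nat.mod_modEq _ _)).add_right _
          _ = c + m * k := by
              obtain ⟨m, rfl⟩ := Nat.exists_eq_succ_of_ne_zero hm.ne'
              simp; ring
          _ ≡ c [MOD m] := by simp [Nat.ModEq]
      rw [Nat.mod_eq_of_lt hc] at this
      exact (show _ % m = c % m from this).trans (Nat.mod_eq_of_lt hc)
    rwa [e] at this

/-! ### Modular witnesses -/

/-- Contexts `u b`, `v b` of equal lengths for the two bits `b` such that the membership of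
`y (nest u v x w) z` in `L` depends exactly on the number of ones in `w` modulo `m`. -/
structure ModWitness {C I R : Type} (L : Language (Letter C I R)) (m : ℕ) where
  u : Bool → List (Letter C I R)
  v : Bool → List (Letter C I R)
  x : List (Letter C I R)
  y : List (Letter C I R)
  z : List (Letter C I R)
  length_u : (u true).length = (u false).length
  length_v : (v true).length = (v false).length
  wellMatched : ∀ b, WellMatched (u b ++ v b)
  wellMatched_core : WellMatched x
  wellMatched_outer : WellMatched (y ++ z)
  two_le : 2 ≤ m
  mem_iff : ∀ w : List Bool, y ++ nest u v x w ++ z ∈ L ↔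
    y ++ nest u v x (List.replicate (w.count true % m) true) ++ z ∈ L
  minimal : ∀ d, 0 < d → d < m → ∃ c < m,
    ¬ (y ++ nest u v x (List.replicate c true) ++ z ∈ L ↔
      y ++ nest u v x (List.replicate ((c + d) % m) true) ++ z ∈ L)

/-- It suffices to test the modularity condition on short words. -/
theorem mem_iff_of_short {Q C I R Γ : Type} [Fintype Q] [Fintype Γ] [DecidableEq Q] [DecidableEq Γ]
    (A : DVPA Q C I R Γ)
    {u v : Bool → List (Letter C I R)} {x y z : List (Letter C I R)} {m : ℕ} (hm : 0 < m)
    (huv : ∀ b, WellMatched (u b ++ v b)) (hx : WellMatched x)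
    (h : ∀ w : List Bool,
      w.length ≤ m * Fintype.card Q ^ (Fintype.card Q * Fintype.card Γ) →
      (y ++ nest u v x w ++ z ∈ A.language ↔
        y ++ nest u v x (List.replicate (w.count true % m) true) ++ z ∈ A.language))
    (w : List Bool) :
    y ++ nest u v x w ++ z ∈ A.language ↔
      y ++ nest u v x (List.replicate (w.count true % m) true) ++ z ∈ A.language := by
  -- This pair decides both sides of the equivalence, and the number of its possible values is the
  -- length bound in `h`.
  let val : List Bool → Fin m × (Q × Γ → Q) := fun w =>
    (⟨w.count true % m, Nat.mod_lt _ hm⟩, A.behaviour (nest u v x w))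
  obtain ⟨w', hw', e⟩ := exists_short_word_value_eq val (by
    intro b w w' e
    simp only [val, Prod.mk.injEq, Fin.mk.injEq] at e ⊢
    constructor
    · rw [List.count_cons, List.count_cons, Nat.add_mod, e.1, ← Nat.add_mod]
    · exact A.behaviour_congr (.nest huv hx w) (.nest huv hx w') e.2 _ _) w
  simp only [val, Prod.mk.injEq, Fin.mk.injEq] at e
  rw [← A.mem_language_congr (.nest huv hx w') (.nest huv hx w) e.2, ← e.1]
  exact h w' (by simpa using hw'.le)

/-! ### Witnesses from groups in the syntactic Ext-algebra -/

theorem syntacticHom_φ_eq_iff {C I R : Type} (L : Language (Letter C I R)) (x x' : WMWord C I R) :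
    (syntacticHom L).φ x = (syntacticHom L).φ x' ↔
      ∀ y z, WellMatched (y ++ z) → (y ++ x.1 ++ z ∈ L ↔ y ++ x'.1 ++ z ∈ L) := by
  have : (syntacticHom L).φ x = (syntacticHom L).φ x' ↔ (syntacticCon L).toSetoid.r x x' :=
    Con.eq (syntacticCon L).toCon
  rw [this]
  constructor
  · intro h y z hyz
    exact h (extMap y z hyz) ⟨y, z, hyz, rfl⟩
  · rintro h _ ⟨y, z, hyz, rfl⟩
    exact h y z hyz

/-- A group in the image of the operations of fixed lengths yields elements of the image that
behave like the identity and a different element of a group. -/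
theorem exists_group_elements {C I R : Type} {L : Language (Letter C I R)}
    (h : ¬ (syntacticHom L).IsQuasiAperiodic) :
    ∃ k l, ∃ e g inv : (syntacticCon L).quotient.ops,
      e ∈ (syntacticHom L).ψ '' extMapsOfLength C I R k l ∧
      g ∈ (syntacticHom L).ψ '' extMapsOfLength C I R k l ∧
      e * e = e ∧ e * g = g ∧ g * e = g ∧ inv * g = e ∧ g ≠ e := by
  simp only [ExtHom.IsQuasiAperiodic, IsAperiodicSemigroup, not_forall] at h
  obtain ⟨k, l, T, hT, G, ⟨e, he, hid, hinv⟩, hG⟩ := h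
  obtain ⟨g, hg, hne⟩ : ∃ g ∈ G, g ≠ e := by
    by_contra! hall
    exact hG fun a ha b hb => (hall a ha).trans (hall b hb).symm
  -- A left inverse is enough: it is used only to cancel powers of `g`.
  obtain ⟨j, hj, -, hjg⟩ := hinv g hg
  exact ⟨k, l, e, g, j, hT e.2, hT g.2, congrArg Subtype.val (hid e he).1,
    congrArg Subtype.val (hid g hg).1, congrArg Subtype.val (hid g hg).2,
    congrArg Subtype.val hjg, fun h => hne (Subtype.ext h)⟩

/-- Zeros are read as the identity of the group and ones as a non-identity element; `m` is the least
period of membership under a separating outer context, which may properly divide the order of that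
element. -/
theorem exists_modWitness {Q C I R Γ : Type} [Finite Q] [Finite Γ] (A : DVPA Q C I R Γ)
    (h : ¬ (syntacticHom A.language).IsQuasiAperiodic) :
    ∃ m, Nonempty (ModWitness A.language m) := by
  classical
  obtain ⟨k, l, _, _, inv, ⟨e, ⟨u₀, v₀, h₀, hu₀, hv₀, he⟩, rfl⟩,
    ⟨g, ⟨u₁, v₁, h₁, hu₁, hv₁, hg⟩, rfl⟩,
    hee, heg, hge, hinv, hne⟩ := exists_group_elements h
  set π := (syntacticHom A.language).φ with hπ
  set ε : (syntacticCon A.language).toCon.Quotient →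
      (syntacticCon A.language).toCon.Quotient :=
    ((syntacticHom A.language).ψ e).1 with hε
  set γ : (syntacticCon A.language).toCon.Quotient →
      (syntacticCon A.language).toCon.Quotient :=
    ((syntacticHom A.language).ψ g).1 with hγ
  set ι : (syntacticCon A.language).toCon.Quotient →
      (syntacticCon A.language).toCon.Quotient := inv.1 with hι
  have hee' : ∀ r, ε (ε r) = ε r := fun r => congrFun (congrArg Subtype.val hee) r
  have heg' : ∀ r, ε (γ r) = γ r := fun r => congrFun (congrArg Subtype.val heg) r
  have hge' : ∀ r, γ (ε r) = γ r := fun r => congrFun (congrArg Subtype.val hge) r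
  have hinv' : ∀ r, ι (γ r) = ε r := fun r => congrFun (congrArg Subtype.val hinv) r
  have hεπ : ∀ x : WMWord C I R, ε (π x) = π (extMap u₀ v₀ h₀ x) := fun x => by
    rw [hε, (syntacticHom A.language).map_apply e x, he]
  have hγπ : ∀ x : WMWord C I R, γ (π x) = π (extMap u₁ v₁ h₁ x) := fun x => by
    rw [hγ, (syntacticHom A.language).map_apply g x, hg]
  obtain ⟨x, hx⟩ : ∃ x : WMWord C I R, γ (π x) ≠ ε (π x) := by
    by_contra! hall
    refine hne (Subtype.ext (funext fun r => ?_))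
    induction r using Con.induction_on with
    | H x => exact hall x
  let u : Bool → List (Letter C I R) := fun b => if b then u₁ else u₀
  let v : Bool → List (Letter C I R) := fun b => if b then v₁ else v₀
  have huv : ∀ b, WellMatched (u b ++ v b) := by
    intro b
    cases b
    · exact h₀
    · exact h₁
  -- `e` is only an idempotent, not the identity map; wrapping the core once makes its class a fixed
  -- point of `ε`.
  let x' : WMWord C I R := extMap u₀ v₀ h₀ x
  let X : List Bool → WMWord C I R := fun w => ⟨nest u v x'.1 w, .nest huv x'.2 w⟩
  let p : ℕ → (syntacticCon A.language).toCon.Quotient := fun c => γ^[c] (π x')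
  have hεp : ∀ c, ε (p c) = p c := by
    intro c
    cases c with
    | zero =>
      change ε (π (extMap u₀ v₀ h₀ x)) = π (extMap u₀ v₀ h₀ x)
      rw [← hεπ, hee']
    | succ c =>
      simp only [p, Function.iterate_succ_apply']
      exact heg' _
  have hX : ∀ w, π (X w) = p (w.count true) := by
    intro w
    induction w with
    | nil => rfl
    | cons b w ih =>
      cases b
      · have : X (false :: w) = extMap u₀ v₀ h₀ (X w) := rfl
        rw [this, ← hεπ, ih, hεp]
        simp
      · have : X (true :: w) = extMap u₁ v₁ h₁ (X w) := rfl
        rw [this, ← hγπ, ih]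
        simp [p, Function.iterate_succ_apply']
  have hXr : ∀ c, π (X (List.replicate c true)) = p c := fun c => by simp [hX]
  -- Two powers collide because behaviours are finite in number and determine syntactic classes;
  -- cancelling with `ι` moves the collision back to 0, so there is no preperiod.
  obtain ⟨n, hn, hpn⟩ : ∃ n, 0 < n ∧ p n = p 0 := by
    obtain ⟨i, j, hij, e⟩ := Finite.exists_ne_map_eq_of_infinite
      (fun c => A.behaviour (X (List.replicate c true)).1)
    wlog hlt : i < j generalizing i j
    · exact this j i hij.symm e.symm (by omega)
    have hp : p i = p j := by
      rw [← hXr, ← hXr, hπ, syntacticHom_φ_eq_iff]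
      exact fun y z _ => A.mem_language_congr (X _).2 (X _).2 e y z
    have hback : ∀ t c, ι^[t] (p (t + c)) = p c := by
      intro t
      induction t with
      | zero => intro c; simp
      | succ t ih =>
        intro c
        have : ι (p (t + 1 + c)) = p (t + c) := by
          have : p (t + 1 + c) = γ (p (t + c)) := by
            simp only [p, ← Function.iterate_succ_apply']
            rw [Nat.succ_eq_add_one, add_right_comm]
          rw [this, hinv', hεp]
        rw [Function.iterate_succ_apply, this, ih]
    refine ⟨j - i, by omega, ?_⟩
    rw [← hback i (j - i), ← hback i 0, Nat.add_sub_cancel' hlt.le, add_zero, hp]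
  have hper : ∀ c, p (c + n) = p c := by
    intro c
    have : p (c + n) = γ^[c] (p n) := by simp [p, Function.iterate_add_apply]
    rw [this, hpn]
    rfl
  have h01 : π (X [true]) ≠ π (X []) := by
    rw [hX, hX]
    change γ (π (extMap u₀ v₀ h₀ x)) ≠ π (extMap u₀ v₀ h₀ x)
    rw [← hεπ, hge']
    exact hx
  rw [Ne, hπ, syntacticHom_φ_eq_iff] at h01
  push Not at h01
  obtain ⟨y, z, hyz, hmem⟩ := h01
  have hs : ∀ w w' : List Bool, p (w.count true) = p (w'.count true) →
      (y ++ nest u v x'.1 w ++ z ∈ A.language ↔ y ++ nest u v x'.1 w' ++ z ∈ A.language) := by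
    intro w w' e
    rw [← hX, ← hX, hπ, syntacticHom_φ_eq_iff] at e
    exact e y z hyz
  obtain ⟨m, hm2, hmod, hmin⟩ := exists_minimal_period
    (s := fun c => y ++ nest u v x'.1 (List.replicate c true) ++ z ∈ A.language) hn
    (fun c => hs _ _ (by simp [hper])) (by
      rintro ⟨a, b⟩
      rcases hmem with ⟨c, d⟩ | ⟨c, d⟩
      · exact d (a c)
      · exact c (b d))
  refine ⟨m, ⟨⟨u, v, x'.1, y, z, hu₁.trans hu₀.symm, hv₁.trans hv₀.symm, huv, x'.2, hyz, hm2,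
    fun w => ?_, hmin⟩⟩⟩
  rw [← hmod]
  exact hs _ _ (by simp)

/-! ### Conjunctions of oracle queries -/

/-- An input of an oracle query: a constant or a literal. -/
abbrev QueryBit (n : ℕ) : Type := Bool ⊕ Fin n × Bool

/-- The value of an input of an oracle query. -/
def QueryBit.value {n : ℕ} (x : Fin n → Bool) : QueryBit n → Bool
  | Sum.inl b => b
  | Sum.inr (i, b) => x i == b

namespace OracleCircuit

/-- The labels of the gates of the conjunction of `k` oracle queries. -/
def conjLabel {n k : ℕ} : QueryBit n ⊕ Fin k ⊕ Unit → GateLabel n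
  -- Constants are gates without inputs: the empty conjunction is true, the empty disjunction false.
  | Sum.inl (Sum.inl true) => GateLabel.and
  | Sum.inl (Sum.inl false) => GateLabel.or
  | Sum.inl (Sum.inr (i, b)) => GateLabel.lit i b
  | Sum.inr (Sum.inl _) => GateLabel.oracle
  | Sum.inr (Sum.inr _) => GateLabel.and

/-- The wires of the conjunction of oracle queries. -/
def conjPreds {n k : ℕ} (q : Fin k → List (QueryBit n)) :
    QueryBit n ⊕ Fin k ⊕ Unit → List (QueryBit n ⊕ Fin k ⊕ Unit)
  | Sum.inl _ => []
  | Sum.inr (Sum.inl t) => (q t).map Sum.inl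
  | Sum.inr (Sum.inr _) => (List.finRange k).map fun t => Sum.inr (Sum.inl t)

/-- The levels of the gates of the conjunction of oracle queries. -/
def conjLevel {n k : ℕ} : QueryBit n ⊕ Fin k ⊕ Unit → ℕ
  | Sum.inl _ => 0
  | Sum.inr (Sum.inl _) => 1
  | Sum.inr (Sum.inr _) => 2

theorem conjLevel_lt {n k : ℕ} (q : Fin k → List (QueryBit n)) {g h : QueryBit n ⊕ Fin k ⊕ Unit}
    (hg : g ∈ conjPreds q h) : conjLevel g < conjLevel h := by
  rcases h with h | h | h
  · simp [conjPreds] at hg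
  · obtain ⟨b, -, rfl⟩ := List.mem_map.mp hg
    simp [conjLevel]
  · obtain ⟨t, -, rfl⟩ := List.mem_map.mp hg
    simp [conjLevel]

/-- The conjunction of oracle queries. -/
def conj {n k : ℕ} (q : Fin k → List (QueryBit n)) : OracleCircuit n where
  Node := QueryBit n ⊕ Fin k ⊕ Unit
  fintypeNode := inferInstance
  label := conjLabel
  preds := conjPreds q
  preds_lit := by
    rintro (g | g | g) i b h
    · rfl
    · cases h
    · cases h
  acyclic := Subrelation.wf (fun h => conjLevel_lt q h) (measure conjLevel).wf
  output := Sum.inr (Sum.inr ())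

variable {n k : ℕ} (q : Fin k → List (QueryBit n))

theorem size_conj : (conj q).size = 2 + n * 2 + (k + 1) := by
  change Fintype.card (QueryBit n ⊕ Fin k ⊕ Unit) = _
  simp [Fintype.card_sum, Fintype.card_prod]

/-- Every wire raises the level, so the level bounds the length of any path ending in the gate. -/
theorem depth_conj_le (g : (conj q).Node) : (conj q).depth g ≤ conjLevel g := by
  induction g using (conj q).acyclic.induction with
  | _ g ih =>
    rw [depth_eq]
    have : ∀ l : List (conj q).Node, (∀ h ∈ l, (conj q).depth h + 1 ≤ conjLevel g) →
        (l.map fun j => (conj q).depth j + 1).foldr max 0 ≤ conjLevel g := by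
      intro l hl
      induction l with
      | nil => simp
      | cons a l ihl =>
        simp only [List.map_cons, List.foldr_cons, max_le_iff]
        exact ⟨hl a (by simp), ihl fun h hh => hl h (by simp [hh])⟩
    exact this _ fun h hh => (ih h hh).trans_lt (conjLevel_lt q hh)

/-- All oracle gates lie on level 1, whereas a path strictly raises the level. -/
theorem isTruthTable_conj : (conj q).IsTruthTable := by
  intro g h hg hh htrans
  have hlt : conjLevel g < conjLevel h := by
    clear hg hh
    induction htrans with
    | single h => exact conjLevel_lt q h
    | tail _ h ih => exact ih.trans (conjLevel_lt q h)
  have hlevel : ∀ g : (conj q).Node, (conj q).label g = GateLabel.oracle → conjLevel g = 1 := by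
    rintro (((_ | _) | _) | g | g) h <;> cases h
    rfl
  rw [hlevel g hg, hlevel h hh] at hlt
  exact lt_irrefl _ hlt

theorem eval_conj_bit (O : Language Bool) (x : Fin n → Bool) (b : QueryBit n) :
    (conj q).eval O x (Sum.inl b) = b.value x := by
  refine (eval_eq _ O x _).trans ?_
  rcases b with (_ | _) | ⟨i, b⟩ <;> rfl

open Classical in
theorem eval_conj_query (O : Language Bool) (x : Fin n → Bool) (t : Fin k) :
    (conj q).eval O x (Sum.inr (Sum.inl t)) = decide ((q t).map (QueryBit.value x) ∈ O) := by
  refine (eval_eq _ O x _).trans ?_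
  exact congrArg (fun l => decide (l ∈ O))
    (List.map_map.trans (List.map_congr_left fun b _ => eval_conj_bit q O x b))

open Classical in
theorem eval_conj_output (O : Language Bool) (x : Fin n → Bool) :
    (conj q).eval O x (conj q).output = true ↔ ∀ t, (q t).map (QueryBit.value x) ∈ O := by
  rw [eval_eq]
  refine List.all_eq_true.trans ⟨fun h t => ?_, fun h c hc => ?_⟩
  · exact decide_eq_true_eq.mp ((eval_conj_query q O x t).symm.trans
      (h _ (List.mem_map_of_mem (List.mem_map_of_mem (List.mem_finRange t)))))
  · obtain ⟨g, hg, rfl⟩ := List.mem_map.mp hc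
    obtain ⟨t, -, rfl⟩ := List.mem_map.mp hg
    exact (eval_conj_query q O x t).trans (decide_eq_true (h t))

end OracleCircuit

/-- A language is reducible to another one if it is decided by a conjunction of a bounded number of
oracle queries of linear length. -/
theorem cdReducible_of_queries {K L : Language Bool} (k a b : ℕ)
    (h : ∀ n, ∃ q : List (List (QueryBit n)), q.length ≤ k ∧ (∀ l ∈ q, l.length ≤ a * n + b) ∧
      ∀ x : Fin n → Bool, List.ofFn x ∈ K ↔ ∀ l ∈ q, l.map (QueryBit.value x) ∈ L) :
    CdReducible K L := by
  -- The polynomial dominates both the size, at most `2 * n + k + 3`, and the query length `a * n +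
  -- b`.
  refine ⟨.C (a + 2) * .X + .C (b + k + 3), 2, fun n => ?_⟩
  obtain ⟨q, hk, hlen, hq⟩ := h n
  refine ⟨.conj q.get, ?_, fun g => (OracleCircuit.depth_conj_le _ g).trans ?_,
    OracleCircuit.isTruthTable_conj _, ?_, fun x => ?_⟩
  · rw [OracleCircuit.size_conj]
    simp
    nlinarith
  · rcases g with g | g | g <;> simp [OracleCircuit.conjLevel]
  · rintro (((_ | _) | _) | t | g) hg <;> cases hg
    change ((q.get t).map Sum.inl).length ≤ _
    have := hlen (q.get t) (List.get_mem q t)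
    simp at this ⊢
    nlinarith
  · rw [OracleCircuit.eval_conj_output, hq]
    simp [List.forall_mem_iff_get]

/-! ### Binary encodings -/

namespace BlockEncoding

variable {S : Type} (E : BlockEncoding S)

/-- The encoding of a word. -/
def encodeWord (w : List S) : List Bool := w.flatMap fun a => List.ofFn (E.block a)

theorem encodeWord_append (w w' : List S) :
    E.encodeWord (w ++ w') = E.encodeWord w ++ E.encodeWord w' := by
  simp [encodeWord]

theorem length_encodeWord (w : List S) : (E.encodeWord w).length = w.length * E.width := by
  simp [encodeWord, List.length_flatMap]

/-- Blocks of one positive width can be split off uniquely. Hence an oracle answer on an encoded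
word is an answer about the word itself. -/
theorem encodeWord_injective : Function.Injective E.encodeWord := by
  intro w
  induction w with
  | nil =>
    intro w' h
    have := congrArg List.length h
    rw [length_encodeWord, length_encodeWord] at this
    have hw := E.width_pos
    rcases w' with _ | ⟨a, w'⟩
    · rfl
    · simp at this
      omega
  | cons a w ih =>
    intro w' h
    rcases w' with _ | ⟨a', w'⟩
    · have := congrArg List.length h
      rw [length_encodeWord, length_encodeWord] at this
      have hw := E.width_pos
      simp at this
      omega
    · simp only [encodeWord, List.flatMap_cons] at h
      obtain ⟨h₁, h₂⟩ := List.append_inj h (by simp)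
      rw [E.injective (List.ofFn_injective h₁), ih h₂]

theorem encodeWord_mem_encode {L : Language S} {w : List S} :
    E.encodeWord w ∈ E.encode L ↔ w ∈ L :=
  ⟨fun ⟨_, hw', e⟩ => E.encodeWord_injective e ▸ hw', fun h => ⟨w, h, rfl⟩⟩

end BlockEncoding

/-! ### The reduction -/

/-- The query input that has the value `a` if the `j`-th input bit is true and `b` otherwise. -/
def QueryBit.select {n : ℕ} (j : Fin n) (a b : Bool) : QueryBit n :=
  if a = b then Sum.inl a else Sum.inr (j, a)

theorem QueryBit.value_select {n : ℕ} (x : Fin n → Bool) (j : Fin n) (a b : Bool) :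
    (QueryBit.select j a b).value x = if x j then a else b := by
  cases a <;> cases b <;> cases h : x j <;> simp [QueryBit.select, QueryBit.value, h]

/-- Equal lengths allow choosing between the two blocks bit by bit, each position depending on one
input only. -/
theorem map_value_zipWith_select {n : ℕ} (x : Fin n → Bool) (j : Fin n) :
    ∀ l l' : List Bool, l.length = l'.length →
      (List.zipWith (QueryBit.select j) l l').map (QueryBit.value x) = if x j then l else l'
  | [], [], _ => by simp
  | a :: l, b :: l', h => by
    have := map_value_zipWith_select x j l l' (by simpa using h)
    simp only [List.zipWith_cons_cons, List.map_cons, this, QueryBit.value_select]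
    split <;> rfl

/-- The query inputs for the encoding of `nest u v X w`, where `w` consists of the input bits with
the given numbers and `base` yields the encoding of `X`. -/
def nestQuery {n : ℕ} (u v : Bool → List Bool) (base : List (QueryBit n)) (js : List (Fin n)) :
    List (QueryBit n) :=
  js.foldr (fun j X => List.zipWith (QueryBit.select j) (u true) (u false) ++ X ++
    List.zipWith (QueryBit.select j) (v true) (v false)) base

theorem map_value_nestQuery {n : ℕ} {u v : Bool → List Bool}
    (hu : (u true).length = (u false).length) (hv : (v true).length = (v false).length)
    (base : List (QueryBit n)) (js : List (Fin n)) (x : Fin n → Bool) :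
    (nestQuery u v base js).map (QueryBit.value x) =
      nest u v (base.map (QueryBit.value x)) (js.map x) := by
  induction js with
  | nil => rfl
  | cons j js ih =>
    rw [List.map_cons, nest_cons, ← ih]
    change (List.zipWith (QueryBit.select j) (u true) (u false) ++ nestQuery u v base js ++
      List.zipWith (QueryBit.select j) (v true) (v false)).map _ = _
    rw [List.map_append, List.map_append, map_value_zipWith_select _ _ _ _ hu,
      map_value_zipWith_select _ _ _ _ hv]
    cases x j <;> rfl

theorem length_nestQuery {n : ℕ} {u v : Bool → List Bool}
    (hu : (u true).length = (u false).length) (hv : (v true).length = (v false).length)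
    (base : List (QueryBit n)) (js : List (Fin n)) :
    (nestQuery u v base js).length =
      js.length * ((u true).length + (v true).length) + base.length := by
  induction js with
  | nil => simp [nestQuery]
  | cons j js ih =>
    change (List.zipWith (QueryBit.select j) (u true) (u false) ++ nestQuery u v base js ++
      List.zipWith (QueryBit.select j) (v true) (v false)).length = _
    simp only [List.length_append, ih, List.length_zipWith, hu, hv, min_self, List.length_cons]
    ring

theorem BlockEncoding.encodeWord_nest {S : Type} (E : BlockEncoding S) (u v : Bool → List S)
    (x : List S) (w : List Bool) :
    E.encodeWord (nest u v x w) =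
      nest (fun b => E.encodeWord (u b)) (fun b => E.encodeWord (v b)) (E.encodeWord x) w := by
  induction w with
  | nil => rfl
  | cons b w ih => simp only [nest_cons, E.encodeWord_append, ih]

theorem ModWitness.cdReducible {C I R : Type} {L : Language (Letter C I R)} {m : ℕ}
    (W : ModWitness L m) (E : BlockEncoding (Letter C I R)) :
    CdReducible (modLanguage m) (E.encode L) := by
  classical
  obtain ⟨u, v, x, y, z, hu, hv, -, -, -, hm, hmem, hmin⟩ := W
  let s : ℕ → Prop := fun c => y ++ nest u v x (List.replicate c true) ++ z ∈ L
  let core : ℕ → List Bool := fun t => E.encodeWord (nest u v x (List.replicate t true))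
  let U : Bool → List Bool := fun b => E.encodeWord (u b)
  let V : Bool → List Bool := fun b => E.encodeWord (v b)
  have hU : (U true).length = (U false).length := by simp [U, E.length_encodeWord, hu]
  have hV : (V true).length = (V false).length := by simp [V, E.length_encodeWord, hv]
  -- The core carries `t` constant ones, which add `t` to the number of ones of the input.
  let query : ∀ n, ℕ → List (QueryBit n) := fun n t =>
    (E.encodeWord y).map Sum.inl ++ nestQuery U V ((core t).map Sum.inl) (List.finRange n) ++
      (E.encodeWord z).map Sum.inl
  -- Each input bit contributes one left and one right block; the sum over all cores gives one
  -- constant valid for every `t < m`.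
  refine cdReducible_of_queries m ((U true).length + (V true).length)
    ((E.encodeWord y).length + (∑ t ∈ Finset.range m, (core t).length) + (E.encodeWord z).length)
    fun n => ⟨((List.range m).filter (s ·)).map (query n), ?_, ?_, fun X => ?_⟩
  · simpa using List.length_filter_le (fun t => decide (s t)) (List.range m)
  · intro l hl
    obtain ⟨t, ht, rfl⟩ := List.mem_map.mp hl
    have ht : t ∈ Finset.range m := by
      simp only [List.mem_filter, List.mem_range] at ht
      simpa using ht.1
    have := Finset.single_le_sum (f := fun t => (core t).length) (fun _ _ => Nat.zero_le _) ht
    simp only [query, List.length_append, List.length_map, length_nestQuery hU hV,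
      List.length_finRange] at this ⊢
    nlinarith
  · have hq : ∀ t, (query n t).map (QueryBit.value X) =
        E.encodeWord (y ++ nest u v x (List.ofFn X ++ List.replicate t true) ++ z) := by
      intro t
      have hconst : ∀ l : List Bool,
          (l.map (Sum.inl : Bool → QueryBit n)).map (QueryBit.value X) = l := fun l => by
        rw [List.map_map]
        exact List.map_id l
      rw [E.encodeWord_append, E.encodeWord_append, nest_append, E.encodeWord_nest]
      simp only [query, List.map_append, hconst, map_value_nestQuery hU hV,
        List.ofFn_eq_map]
      rfl
    have hs : ∀ t, y ++ nest u v x (List.ofFn X ++ List.replicate t true) ++ z ∈ L ↔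
        s (((List.ofFn X).count true + t) % m) := by
      intro t
      rw [hmem]
      simp [s]
    change m ∣ _ ↔ _
    rw [dvd_iff_forall_shift (s := s) (by omega) hmin]
    simp only [List.forall_mem_map, List.mem_filter, List.mem_range, decide_eq_true_eq, hq,
      E.encodeWord_mem_encode, hs, and_imp]

/-! ### Numerical simulation of automata -/

/-- Numbered words: a letter is given by its kind (`0` for calls, `1` for internal letters, `2` for
returns) and its number. -/
abbrev NumWord : Type := List (ℕ × ℕ)

/-- The numbered form of a letter. -/
def Letter.num {c i r : ℕ} : Letter (Fin c) (Fin i) (Fin r) → ℕ × ℕ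
  | .call a => (0, a)
  | .int a => (1, a)
  | .ret a => (2, a)

namespace DVPACode

/-- The entry of a three-dimensional table. -/
def entry {α : Type} (d : α) (T : List (List (List α))) (s a t : ℕ) : α :=
  -- Defaults only make the lookup total; on codes of automata all indices used are in range.
  ((T.getD s []).getD a []).getD t d

/-- The number of states. -/
def states (D : DVPACode) : ℕ := D.1.1

/-- The number of call letters. -/
def calls (D : DVPACode) : ℕ := D.1.2.1

/-- The number of internal letters. -/
def ints (D : DVPACode) : ℕ := D.1.2.2.1

/-- The number of return letters. -/
def rets (D : DVPACode) : ℕ := D.1.2.2.2.1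

/-- The number of stack symbols. -/
def symbols (D : DVPACode) : ℕ := D.1.2.2.2.2

/-- The initial state. -/
def start (D : DVPACode) : ℕ := D.2.1.1

/-- The bottom symbol. -/
def bot (D : DVPACode) : ℕ := D.2.1.2

/-- The characteristic list of the set of final states. -/
def final (D : DVPACode) : List Bool := D.2.2.1

/-- The call table. -/
def callTable (D : DVPACode) : List (List (List (ℕ × ℕ))) := D.2.2.2.1

/-- The table of the internal letters. -/
def intTable (D : DVPACode) : List (List (List ℕ)) := D.2.2.2.2.1

/-- The return table. -/
def retTable (D : DVPACode) : List (List (List ℕ)) := D.2.2.2.2.2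

/-- One step of the described automaton in state `s` with topmost stack symbol `α`, above `β`. -/
def stepCons (D : DVPACode) (s : ℕ) (l : ℕ × ℕ) (α : ℕ) (β : List ℕ) : ℕ × List ℕ :=
  if l.1 = 0 then
    ((entry (0, 0) D.callTable s l.2 α).1, (entry (0, 0) D.callTable s l.2 α).2 :: α :: β)
  else if l.1 = 1 then (entry 0 D.intTable s l.2 α, α :: β)
  else (entry 0 D.retTable s l.2 α, β)

/-- One step of the described automaton. -/
def step (D : DVPACode) (σ : ℕ × List ℕ) (l : ℕ × ℕ) : ℕ × List ℕ :=
  σ.2.casesOn (σ.1, []) (D.stepCons σ.1 l)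

/-- The configuration that the described automaton reaches on a word. -/
def runFrom (D : DVPACode) (σ : ℕ × List ℕ) (w : NumWord) : ℕ × List ℕ := w.foldl D.step σ

/-- The described automaton accepts a word. -/
def Accepts (D : DVPACode) (w : NumWord) : Prop :=
  D.final.getD (D.runFrom (D.start, [D.bot]) w).1 false = true ∧
    (D.runFrom (D.start, [D.bot]) w).2 = [D.bot]

/-- A bound for the number of pairs of a behaviour and a residue modulo `m`. -/
def shortBound (D : DVPACode) (m : ℕ) : ℕ := m * D.states ^ (D.states * D.symbols)

/-- The letter belongs to the alphabet of the described automaton. -/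
def IsLetter (D : DVPACode) (l : ℕ × ℕ) : Prop :=
  l.1 = 0 ∧ l.2 < D.calls ∨ l.1 = 1 ∧ l.2 < D.ints ∨ l.1 = 2 ∧ l.2 < D.rets

end DVPACode

/-- The height of the stack after a letter; heights are increased by one, and `0` stands for the
failure state. -/
def heightStep (h : ℕ) (l : ℕ × ℕ) : ℕ :=
  if h = 0 then 0 else if l.1 = 0 then h + 1 else if l.1 = 1 then h else h - 1

/-- The numbered word is a well-matched word over the alphabet of the described automaton. -/
def DVPACode.IsWellMatched (D : DVPACode) (w : NumWord) : Prop :=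
  (∀ l ∈ w, D.IsLetter l) ∧ w.foldl heightStep 1 = 1

/-- The bit words of length at most `n`. -/
def boolWords (n : ℕ) : List (List Bool) :=
  -- The explicit recursor matches `Primrec.nat_rec₁`.
  n.rec [[]] fun _ W => [] :: W.flatMap fun w => [false :: w, true :: w]

theorem mem_boolWords {n : ℕ} {w : List Bool} : w ∈ boolWords n ↔ w.length ≤ n := by
  induction n generalizing w with
  | zero => simp [boolWords]
  | succ n ih =>
    change w ∈ [] :: (boolWords n).flatMap _ ↔ _
    rcases w with _ | ⟨_ | _, w⟩ <;> simp [ih]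

/-- Numerical data for modular witnesses: the words `u`, `v` for the two bits, the words `x`, `y`,
`z`, and the modulus. -/
abbrev NumWitness : Type :=
  ((NumWord × NumWord) × (NumWord × NumWord)) × (NumWord × NumWord × NumWord) × ℕ

namespace NumWitness

/-- The left contexts. -/
def u (K : NumWitness) (b : Bool) : NumWord := bif b then K.1.1.1 else K.1.1.2

/-- The right contexts. -/
def v (K : NumWitness) (b : Bool) : NumWord := bif b then K.1.2.1 else K.1.2.2

/-- The innermost word. -/
def x (K : NumWitness) : NumWord := K.2.1.1

/-- The left part of the outer context. -/
def y (K : NumWitness) : NumWord := K.2.1.2.1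

/-- The right part of the outer context. -/
def z (K : NumWitness) : NumWord := K.2.1.2.2

/-- The modulus. -/
def m (K : NumWitness) : ℕ := K.2.2

/-- The word whose acceptance is to depend on the number of ones in the bit word. -/
def word (K : NumWitness) (w : List Bool) : NumWord := K.y ++ nest K.u K.v K.x w ++ K.z

/-- The finitely many conditions on numerical data that have to be tested. -/
def IsValid (D : DVPACode) (K : NumWitness) : Prop :=
  ((K.u true).length = (K.u false).length ∧ (K.v true).length = (K.v false).length) ∧
  ((D.IsWellMatched (K.u false ++ K.v false) ∧ D.IsWellMatched (K.u true ++ K.v true)) ∧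
    D.IsWellMatched K.x ∧ D.IsWellMatched (K.y ++ K.z)) ∧
  2 ≤ K.m ∧
  (∀ w ∈ boolWords (D.shortBound K.m), D.Accepts (K.word w) ↔
    D.Accepts (K.word (List.replicate (w.count true % K.m) true))) ∧
  ∀ d < K.m, 0 < d → ∃ c < K.m, ¬ (D.Accepts (K.word (List.replicate c true)) ↔
    D.Accepts (K.word (List.replicate ((c + d) % K.m) true)))

end NumWitness

/-! ### Correctness of the simulation -/

section Correctness

variable {q c i r g : ℕ}

theorem DVPACode.entry_ofFn {α : Type} (d : α) (f : Fin q → Fin c → Fin g → α) (s : Fin q)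
    (a : Fin c) (t : Fin g) :
    entry d (List.ofFn fun s => List.ofFn fun a => List.ofFn fun t => f s a t) s a t =
      f s a t := by
  simp [entry, List.getD_eq_getElem?_getD]

variable (A : DVPA (Fin q) (Fin c) (Fin i) (Fin r) (Fin g))

theorem DVPA.runFrom_code (w : List (Letter (Fin c) (Fin i) (Fin r))) (s : Fin q)
    (β : List (Fin g)) :
    A.code.runFrom (s, β.map Fin.val) (w.map Letter.num) =
      (((A.run s w β).1 : ℕ), (A.run s w β).2.map Fin.val) := by
  induction w generalizing s β with
  | nil => simp [DVPACode.runFrom, DVPA.run]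
  | cons l w ih =>
    change A.code.runFrom (A.code.step (s, β.map Fin.val) l.num) (w.map Letter.num) = _
    rcases β with _ | ⟨α, β⟩
    · have := ih s []
      simp only [A.run_empty_stack] at this ⊢
      exact this
    · have hstep : A.code.step (s, (α :: β).map Fin.val) l.num =
          (((A.run s [l] (α :: β)).1 : ℕ), (A.run s [l] (α :: β)).2.map Fin.val) := by
        rcases l with a | a | a
        · have := DVPACode.entry_ofFn (0, 0)
            (fun s a α => (((A.onCall s a α).1 : ℕ), ((A.onCall s a α).2.1 : ℕ))) s a α
          simp [DVPACode.step, DVPACode.stepCons, Letter.num, DVPA.run, DVPACode.callTable,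
            DVPA.code] at this ⊢
          simp [this]
        · have := DVPACode.entry_ofFn 0 (fun s a α => ((A.onInt s a α : Fin q) : ℕ)) s a α
          simp [DVPACode.step, DVPACode.stepCons, Letter.num, DVPA.run, DVPACode.intTable,
            DVPA.code] at this ⊢
          simp [this]
        · have := DVPACode.entry_ofFn 0 (fun s a α => ((A.onRet s a α : Fin q) : ℕ)) s a α
          simp [DVPACode.step, DVPACode.stepCons, Letter.num, DVPA.run, DVPACode.retTable,
            DVPA.code] at this ⊢
          simp [this]
      rw [hstep, ih, ← A.run_append]
      rfl

theorem DVPA.accepts_code_iff (w : List (Letter (Fin c) (Fin i) (Fin r))) :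
    A.code.Accepts (w.map Letter.num) ↔ w ∈ A.language := by
  have h := A.runFrom_code w A.start [A.bot]
  have h' : A.code.runFrom (A.code.start, [A.code.bot]) (w.map Letter.num) = _ := h
  rw [DVPACode.Accepts, h']
  change _ ↔ (_ ∧ _)
  refine and_congr ?_ ?_
  · simp [DVPACode.final, DVPA.code, List.getD_eq_getElem?_getD]
  · exact ⟨fun e => List.map_injective_iff.mpr Fin.val_injective e, fun e => by rw [e]; rfl⟩

theorem DVPA.isLetter_code_iff (l : ℕ × ℕ) :
    A.code.IsLetter l ↔ ∃ l' : Letter (Fin c) (Fin i) (Fin r), l'.num = l := by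
  obtain ⟨k, a⟩ := l
  constructor
  · rintro (⟨h, h'⟩ | ⟨h, h'⟩ | ⟨h, h'⟩) <;> simp only at h <;> subst h
    · exact ⟨.call ⟨a, h'⟩, rfl⟩
    · exact ⟨.int ⟨a, h'⟩, rfl⟩
    · exact ⟨.ret ⟨a, h'⟩, rfl⟩
  · rintro ⟨b | b | b, h⟩ <;> cases h
    · exact Or.inl ⟨rfl, b.2⟩
    · exact Or.inr (Or.inl ⟨rfl, b.2⟩)
    · exact Or.inr (Or.inr ⟨rfl, b.2⟩)

theorem foldl_heightStep_zero (w : NumWord) : w.foldl heightStep 0 = 0 := by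
  induction w with
  | nil => rfl
  | cons l w ih => simpa [heightStep] using ih

theorem WellMatched.foldl_heightStep {w : List (Letter (Fin c) (Fin i) (Fin r))}
    (hw : WellMatched w) (h : ℕ) : (w.map Letter.num).foldl heightStep (h + 1) = h + 1 := by
  induction hw generalizing h with
  | nil => rfl
  | int c => simp [Letter.num, heightStep]
  | wrap a b hw ih =>
    have : heightStep (h + 1) (Letter.num (.call a : Letter (Fin c) (Fin i) (Fin r))) =
      h + 1 + 1 := by simp [Letter.num, heightStep]
    simp only [List.map_cons, List.foldl_cons, List.map_append, List.foldl_append, this, ih]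
    simp [Letter.num, heightStep]
  | append hu hv ihu ihv => simp [ihu, ihv]

/-- Words that lower the stack height by `k`. -/
def LowersHeight {C I R : Type} : ℕ → List (Letter C I R) → Prop
  | 0, w => WellMatched w
  | k + 1, w => ∃ w₀ b w₁, WellMatched w₀ ∧ w = w₀ ++ Letter.ret b :: w₁ ∧ LowersHeight k w₁

theorem LowersHeight.append_left {C I R : Type} {k : ℕ} {p w : List (Letter C I R)}
    (hp : WellMatched p) (hw : LowersHeight k w) : LowersHeight k (p ++ w) := by
  cases k with
  | zero => exact hp.append hw
  | succ k =>
    obtain ⟨w₀, b, w₁, h₀, rfl, h₁⟩ := hw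
    exact ⟨p ++ w₀, b, w₁, hp.append h₀, by simp, h₁⟩

/-- Induction on the word, with `k` pending returns. A leading call raises `k` by one, and the first
pending return of the remainder is its match, so both wrap a well-matched word. -/
theorem lowersHeight_of_foldl_heightStep (w : List (Letter (Fin c) (Fin i) (Fin r))) (k : ℕ)
    (h : (w.map Letter.num).foldl heightStep (k + 1) = 1) : LowersHeight k w := by
  induction w generalizing k with
  | nil =>
    obtain rfl : k = 0 := by simpa using h
    exact .nil
  | cons l w ih =>
    simp only [List.map_cons, List.foldl_cons] at h
    rcases l with a | a | a
    · obtain ⟨w₀, b, w₁, h₀, rfl, h₁⟩ := ih (k + 1) (by simpa [heightStep, Letter.num] using h)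
      simpa using LowersHeight.append_left (WellMatched.wrap a b h₀) h₁
    · exact (ih k (by simpa [heightStep, Letter.num] using h)).append_left (.int a)
    · cases k with
      | zero => simp [heightStep, Letter.num, foldl_heightStep_zero] at h
      | succ k =>
        exact ⟨[], a, w, .nil, rfl, ih k (by simpa [heightStep, Letter.num] using h)⟩

theorem DVPA.exists_num_eq {w : NumWord} (hw : ∀ l ∈ w, A.code.IsLetter l) :
    ∃ w' : List (Letter (Fin c) (Fin i) (Fin r)), w'.map Letter.num = w := by
  have : w ∈ Set.range (List.map (Letter.num (c := c) (i := i) (r := r))) := by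
    rw [Set.range_list_map]
    exact fun l hl => (A.isLetter_code_iff l).mp (hw l hl)
  exact this

theorem DVPA.isWellMatched_code_iff (w : List (Letter (Fin c) (Fin i) (Fin r))) :
    A.code.IsWellMatched (w.map Letter.num) ↔ WellMatched w := by
  refine ⟨fun h => lowersHeight_of_foldl_heightStep w 0 h.2,
    fun h => ⟨fun l hl => ?_, h.foldl_heightStep 0⟩⟩
  obtain ⟨l', -, rfl⟩ := List.mem_map.mp hl
  exact (A.isLetter_code_iff _).mpr ⟨l', rfl⟩

/-- The numerical form of words. -/
def numWitness (u v : Bool → List (Letter (Fin c) (Fin i) (Fin r)))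
    (x y z : List (Letter (Fin c) (Fin i) (Fin r))) (m : ℕ) : NumWitness :=
  ((((u true).map Letter.num, (u false).map Letter.num),
    ((v true).map Letter.num, (v false).map Letter.num)),
    (x.map Letter.num, y.map Letter.num, z.map Letter.num), m)

theorem word_numWitness (u v : Bool → List (Letter (Fin c) (Fin i) (Fin r)))
    (x y z : List (Letter (Fin c) (Fin i) (Fin r))) (m : ℕ) (w : List Bool) :
    (numWitness u v x y z m).word w = (y ++ nest u v x w ++ z).map Letter.num := by
  rw [List.map_append, List.map_append, nest_map]
  have hu : (numWitness u v x y z m).u = fun b => (u b).map Letter.num := by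
    funext b; cases b <;> rfl
  have hv : (numWitness u v x y z m).v = fun b => (v b).map Letter.num := by
    funext b; cases b <;> rfl
  rw [NumWitness.word, hu, hv]
  rfl

/-- On codes, the numerical tests become the fields of `ModWitness`, with `mem_iff` restricted to
short bit words. -/
theorem isValid_numWitness_iff (u v : Bool → List (Letter (Fin c) (Fin i) (Fin r)))
    (x y z : List (Letter (Fin c) (Fin i) (Fin r))) (m : ℕ) :
    (numWitness u v x y z m).IsValid A.code ↔
      ((u true).length = (u false).length ∧ (v true).length = (v false).length) ∧
      ((WellMatched (u false ++ v false) ∧ WellMatched (u true ++ v true)) ∧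
        WellMatched x ∧ WellMatched (y ++ z)) ∧
      2 ≤ m ∧
      (∀ w ∈ boolWords (m * q ^ (q * g)), y ++ nest u v x w ++ z ∈ A.language ↔
        y ++ nest u v x (List.replicate (w.count true % m) true) ++ z ∈ A.language) ∧
      ∀ d < m, 0 < d → ∃ c < m, ¬ (y ++ nest u v x (List.replicate c true) ++ z ∈ A.language ↔
        y ++ nest u v x (List.replicate ((c + d) % m) true) ++ z ∈ A.language) := by
  unfold NumWitness.IsValid
  simp only [word_numWitness, A.accepts_code_iff]
  simp only [numWitness, NumWitness.u, NumWitness.v, NumWitness.x, NumWitness.y, NumWitness.z,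
    NumWitness.m, cond_true, cond_false, List.length_map, ← List.map_append,
    A.isWellMatched_code_iff]
  rfl

/-- Modular witnesses yield valid numerical data. -/
theorem ModWitness.exists_isValid {m : ℕ} (W : ModWitness A.language m) :
    ∃ K : NumWitness, K.IsValid A.code :=
  ⟨numWitness W.u W.v W.x W.y W.z m, (isValid_numWitness_iff A ..).mpr
    ⟨⟨W.length_u, W.length_v⟩, ⟨⟨W.wellMatched false, W.wellMatched true⟩, W.wellMatched_core,
      W.wellMatched_outer⟩, W.two_le, fun w _ => W.mem_iff w, fun d hd hd0 => W.minimal d hd0 hd⟩⟩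

/-- Valid numerical data yield a modular witness. -/
theorem NumWitness.IsValid.modWitness {K : NumWitness} (hK : K.IsValid A.code) :
    Nonempty (ModWitness A.language K.m) := by
  -- The well-matchedness tests also check that all letters belong to the alphabet, so arbitrary
  -- valid data come from genuine words.
  obtain ⟨u, v, x, y, z, m, rfl⟩ : ∃ (u v : Bool → List (Letter (Fin c) (Fin i) (Fin r)))
      (x y z : List (Letter (Fin c) (Fin i) (Fin r))) (m : ℕ), numWitness u v x y z m = K := by
    obtain ⟨-, ⟨⟨h₀, h₁⟩, hx, hyz⟩, -⟩ := hK
    obtain ⟨x, hx⟩ := A.exists_num_eq hx.1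
    obtain ⟨y, hy⟩ := A.exists_num_eq fun l hl => hyz.1 l (List.mem_append_left _ hl)
    obtain ⟨z, hz⟩ := A.exists_num_eq fun l hl => hyz.1 l (List.mem_append_right _ hl)
    obtain ⟨u₀, hu₀⟩ := A.exists_num_eq fun l hl => h₀.1 l (List.mem_append_left _ hl)
    obtain ⟨v₀, hv₀⟩ := A.exists_num_eq fun l hl => h₀.1 l (List.mem_append_right _ hl)
    obtain ⟨u₁, hu₁⟩ := A.exists_num_eq fun l hl => h₁.1 l (List.mem_append_left _ hl)
    obtain ⟨v₁, hv₁⟩ := A.exists_num_eq fun l hl => h₁.1 l (List.mem_append_right _ hl)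
    refine ⟨fun b => bif b then u₁ else u₀, fun b => bif b then v₁ else v₀, x, y, z, K.m, ?_⟩
    simp only [numWitness, cond_true, cond_false, hx, hy, hz, hu₀, hu₁, hv₀, hv₁]
    rfl
  obtain ⟨⟨hu, hv⟩, ⟨⟨h₀, h₁⟩, hx, hyz⟩, hm, hmem, hmin⟩ := (isValid_numWitness_iff A ..).mp hK
  have huv : ∀ b, WellMatched (u b ++ v b) := fun b => by cases b <;> assumption
  change Nonempty (ModWitness A.language m)
  exact ⟨⟨u, v, x, y, z, hu, hv, huv, hx, hyz, hm,
    mem_iff_of_short A (zero_lt_two.trans_le hm) huv hx fun w hw =>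
      hmem w (mem_boolWords.mpr (by simpa using hw)), fun d hd hd' => hmin d hd' hd⟩⟩

end Correctness

/-! ### The test is primitive recursive -/

theorem PrimrecPred.iff {α : Type} [Primcodable α] {p q : α → Prop} (hp : PrimrecPred p)
    (hq : PrimrecPred q) : PrimrecPred fun a => (p a ↔ q a) :=
  ((hp.and hq).or (hp.not.and hq.not)).of_eq fun a => by tauto

/-- Bounded universal quantification over the entries of a list with parameters. -/
theorem PrimrecPred.forall_mem_of_list {α β : Type} [Primcodable α] [Primcodable β] {f : α → List β}
    {p : α → β → Prop} (hp : PrimrecPred fun s : α × β => p s.1 s.2) (hf : Primrec f) :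
    PrimrecPred fun a => ∀ b ∈ f a, p a b :=
  (PrimrecRel.forall_mem_list (R := fun b a => p a b)
    (hp.comp (Primrec.snd.pair Primrec.fst))).comp hf Primrec.id

/-- Bounded existential quantification over the entries of a list with parameters. -/
theorem PrimrecPred.exists_mem_of_list {α β : Type} [Primcodable α] [Primcodable β] {f : α → List β}
    {p : α → β → Prop} (hp : PrimrecPred fun s : α × β => p s.1 s.2) (hf : Primrec f) :
    PrimrecPred fun a => ∃ b ∈ f a, p a b :=
  (PrimrecRel.exists_mem_list (R := fun b a => p a b)
    (hp.comp (Primrec.snd.pair Primrec.fst))).comp hf Primrec.id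

section Primrec

open Primrec

variable {α : Type} [Primcodable α]

theorem primrec_count_true : Primrec fun w : List Bool => w.count true :=
  (list_foldr (f := id) (g := fun _ => 0)
    (h := fun (_ : List Bool) (s : Bool × ℕ) => bif s.1 then s.2 + 1 else s.2) .id (.const 0)
    (cond (fst.comp snd) (succ.comp (snd.comp snd)) (snd.comp snd)).to₂).of_eq fun w => by
      induction w with
      | nil => rfl
      | cons b w ih =>
        simp only [id_eq] at ih
        cases b <;> simp [ih]

theorem primrec_replicate_true : Primrec fun n : ℕ => List.replicate n true :=
  (list_map list_range (Primrec₂.const true)).of_eq fun n => by simp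

theorem primrec_boolWords : Primrec boolWords :=
  nat_rec₁ [[]] (Primrec₂.comp list_cons (.const [])
    (list_flatMap snd ((list_cons.comp (list_cons.comp (.const false) snd) (list_cons.comp
      (list_cons.comp (.const true) snd) (.const []))).to₂ :
      Primrec₂ fun (_ : ℕ × List (List Bool)) (w : List Bool) => [false :: w, true :: w])))

theorem primrec_nest {u v : α → Bool → NumWord} {x : α → NumWord} {w : α → List Bool}
    (hu : Primrec₂ u) (hv : Primrec₂ v) (hx : Primrec x) (hw : Primrec w) :
    Primrec fun a => nest (u a) (v a) (x a) (w a) :=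
  list_foldr (h := fun a s => u a s.1 ++ s.2 ++ v a s.1) hw hx
    (list_append.comp (list_append.comp (hu.comp fst (fst.comp snd)) (snd.comp snd))
      (hv.comp fst (fst.comp snd))).to₂

theorem primrec_u : Primrec₂ NumWitness.u :=
  (cond snd (fst.comp (fst.comp (fst.comp fst))) (snd.comp (fst.comp (fst.comp fst)))).to₂

theorem primrec_v : Primrec₂ NumWitness.v :=
  (cond snd (fst.comp (snd.comp (fst.comp fst))) (snd.comp (snd.comp (fst.comp fst)))).to₂

theorem primrec_x : Primrec NumWitness.x := fst.comp (fst.comp snd)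

theorem primrec_y : Primrec NumWitness.y := fst.comp (snd.comp (fst.comp snd))

theorem primrec_z : Primrec NumWitness.z := snd.comp (snd.comp (fst.comp snd))

theorem primrec_m : Primrec NumWitness.m := snd.comp snd

theorem primrec_word : Primrec₂ NumWitness.word :=
  (list_append.comp (list_append.comp (primrec_y.comp fst) (primrec_nest
    (u := fun p : NumWitness × List Bool => p.1.u) (v := fun p => p.1.v)
    (primrec_u.comp (fst.comp fst) snd).to₂ (primrec_v.comp (fst.comp fst) snd).to₂
    (primrec_x.comp fst) snd)) (primrec_z.comp fst)).to₂

theorem primrec_states : Primrec DVPACode.states := fst.comp fst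

theorem primrec_calls : Primrec DVPACode.calls := fst.comp (snd.comp fst)

theorem primrec_ints : Primrec DVPACode.ints := fst.comp (snd.comp (snd.comp fst))

theorem primrec_rets : Primrec DVPACode.rets := fst.comp (snd.comp (snd.comp (snd.comp fst)))

theorem primrec_symbols : Primrec DVPACode.symbols :=
  snd.comp (snd.comp (snd.comp (snd.comp fst)))

theorem primrec_start : Primrec DVPACode.start := fst.comp (fst.comp snd)

theorem primrec_bot : Primrec DVPACode.bot := snd.comp (fst.comp snd)

theorem primrec_final : Primrec DVPACode.final := fst.comp (snd.comp snd)

theorem primrec_callTable : Primrec DVPACode.callTable := fst.comp (snd.comp (snd.comp snd))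

theorem primrec_intTable : Primrec DVPACode.intTable :=
  fst.comp (snd.comp (snd.comp (snd.comp snd)))

theorem primrec_retTable : Primrec DVPACode.retTable :=
  snd.comp (snd.comp (snd.comp (snd.comp snd)))

theorem primrec_entry {β : Type} [Primcodable β] (d : β) {T : α → List (List (List β))}
    {s a t : α → ℕ} (hT : Primrec T) (hs : Primrec s) (ha : Primrec a) (ht : Primrec t) :
    Primrec fun x => DVPACode.entry d (T x) (s x) (a x) (t x) :=
  (list_getD d).comp ((list_getD []).comp ((list_getD []).comp hT hs) ha) ht

theorem primrec_stepCons {D : α → DVPACode} {s t : α → ℕ} {l : α → ℕ × ℕ} {β : α → List ℕ}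
    (hD : Primrec D) (hs : Primrec s) (hl : Primrec l) (ht : Primrec t) (hβ : Primrec β) :
    Primrec fun a => (D a).stepCons (s a) (l a) (t a) (β a) := by
  have hcall := primrec_entry (0, 0) (primrec_callTable.comp hD) hs (snd.comp hl) ht
  have hint := primrec_entry 0 (primrec_intTable.comp hD) hs (snd.comp hl) ht
  have hret := primrec_entry 0 (primrec_retTable.comp hD) hs (snd.comp hl) ht
  have hstack := list_cons.comp ht hβ
  exact Primrec.ite (Primrec.eq.comp (fst.comp hl) (.const 0))
    ((fst.comp hcall).pair (list_cons.comp (snd.comp hcall) hstack))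
    (Primrec.ite (Primrec.eq.comp (fst.comp hl) (.const 1)) (hint.pair hstack) (hret.pair hβ))

theorem primrec_step {D : α → DVPACode} {σ : α → ℕ × List ℕ} {l : α → ℕ × ℕ}
    (hD : Primrec D) (hσ : Primrec σ) (hl : Primrec l) :
    Primrec fun a => (D a).step (σ a) (l a) :=
  list_casesOn (snd.comp hσ) ((fst.comp hσ).pair (.const []))
    (primrec_stepCons (hD.comp fst) ((fst.comp hσ).comp fst) (hl.comp fst) (fst.comp snd)
      (snd.comp snd)).to₂

theorem primrecRel_accepts : PrimrecRel DVPACode.Accepts := by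
  have hbot : Primrec fun p : DVPACode × NumWord => p.1.bot := primrec_bot.comp fst
  have hbots : Primrec fun p : DVPACode × NumWord => [p.1.bot] :=
    list_cons.comp hbot (.const [])
  have hrun : Primrec fun p : DVPACode × NumWord => p.1.runFrom (p.1.start, [p.1.bot]) p.2 :=
    list_foldl (h := fun (p : DVPACode × NumWord) (s : (ℕ × List ℕ) × (ℕ × ℕ)) =>
      p.1.step s.1 s.2) snd ((primrec_start.comp fst).pair hbots)
      (primrec_step (fst.comp fst) (fst.comp snd) (snd.comp snd)).to₂
  exact PrimrecPred.and
    (Primrec.eq.comp ((list_getD false).comp (primrec_final.comp fst) (fst.comp hrun))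
      (.const true))
    (Primrec.eq.comp (snd.comp hrun) hbots)

theorem primrecRel_isLetter : PrimrecRel DVPACode.IsLetter := by
  have hk : Primrec fun p : DVPACode × ℕ × ℕ => p.2.1 := fst.comp snd
  have ha : Primrec fun p : DVPACode × ℕ × ℕ => p.2.2 := snd.comp snd
  exact ((Primrec.eq.comp hk (.const 0)).and (nat_lt.comp ha (primrec_calls.comp fst))).or
    (((Primrec.eq.comp hk (.const 1)).and (nat_lt.comp ha (primrec_ints.comp fst))).or
      ((Primrec.eq.comp hk (.const 2)).and (nat_lt.comp ha (primrec_rets.comp fst))))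

theorem primrec_heightStep : Primrec₂ heightStep :=
  (Primrec.ite (Primrec.eq.comp fst (.const 0)) (.const 0)
    (Primrec.ite (Primrec.eq.comp (fst.comp snd) (.const 0)) (succ.comp fst)
      (Primrec.ite (Primrec.eq.comp (fst.comp snd) (.const 1)) fst (pred.comp fst)))).to₂

theorem primrecRel_isWellMatched : PrimrecRel DVPACode.IsWellMatched := by
  have h₁ : PrimrecPred fun p : DVPACode × NumWord => ∀ l ∈ p.2, p.1.IsLetter l :=
    PrimrecPred.forall_mem_of_list (p := fun (p : DVPACode × NumWord) l => p.1.IsLetter l)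
      (primrecRel_isLetter.comp (fst.comp fst) snd) snd
  have h₂ : Primrec fun p : DVPACode × NumWord => p.2.foldl heightStep 1 :=
    list_foldl (h := fun (_ : DVPACode × NumWord) (s : ℕ × ℕ × ℕ) => heightStep s.1 s.2)
      snd (.const 1) (primrec_heightStep.comp (fst.comp snd) (snd.comp snd)).to₂
  exact h₁.and (Primrec.eq.comp h₂ (.const 1))

theorem primrec_shortBound : Primrec₂ DVPACode.shortBound :=
  (nat_mul.comp snd ((Primrec₂.unpaired'.mp Nat.Primrec.pow).comp (primrec_states.comp fst)
    (nat_mul.comp (primrec_states.comp fst) (primrec_symbols.comp fst)))).to₂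

theorem primrecPred_accepts_word {D : α → DVPACode} {K : α → NumWitness} {w : α → List Bool}
    (hD : Primrec D) (hK : Primrec K) (hw : Primrec w) :
    PrimrecPred fun a => (D a).Accepts ((K a).word (w a)) :=
  primrecRel_accepts.comp hD (primrec_word.comp hK hw)

theorem primrecPred_short : PrimrecPred fun p : DVPACode × NumWitness =>
    ∀ w ∈ boolWords (p.1.shortBound p.2.m), p.1.Accepts (p.2.word w) ↔
      p.1.Accepts (p.2.word (List.replicate (w.count true % p.2.m) true)) := by
  refine PrimrecPred.forall_mem_of_list (p := fun (p : DVPACode × NumWitness) w =>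
    (p.1.Accepts (p.2.word w) ↔
      p.1.Accepts (p.2.word (List.replicate (w.count true % p.2.m) true)))) ?_
    (primrec_boolWords.comp (primrec_shortBound.comp fst (primrec_m.comp snd)))
  exact (primrecPred_accepts_word (fst.comp fst) (snd.comp fst) snd).iff
    (primrecPred_accepts_word (fst.comp fst) (snd.comp fst) (primrec_replicate_true.comp
      (nat_mod.comp (primrec_count_true.comp snd) (primrec_m.comp (snd.comp fst)))))

theorem primrecPred_minimal : PrimrecPred fun p : DVPACode × NumWitness =>
    ∀ d < p.2.m, 0 < d → ∃ c < p.2.m, ¬ (p.1.Accepts (p.2.word (List.replicate c true)) ↔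
      p.1.Accepts (p.2.word (List.replicate ((c + d) % p.2.m) true))) := by
  have hbase : PrimrecPred fun p : ((DVPACode × NumWitness) × ℕ) × ℕ =>
      ¬ (p.1.1.1.Accepts (p.1.1.2.word (List.replicate p.2 true)) ↔
        p.1.1.1.Accepts (p.1.1.2.word (List.replicate ((p.2 + p.1.2) % p.1.1.2.m) true))) :=
    ((primrecPred_accepts_word (fst.comp (fst.comp fst)) (snd.comp (fst.comp fst))
      (primrec_replicate_true.comp snd)).iff (primrecPred_accepts_word (fst.comp (fst.comp fst))
      (snd.comp (fst.comp fst)) (primrec_replicate_true.comp (nat_mod.comp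
        (nat_add.comp snd (snd.comp fst)) (primrec_m.comp (snd.comp (fst.comp fst))))))).not
  have hex := PrimrecPred.exists_mem_of_list (p := fun (p : (DVPACode × NumWitness) × ℕ) c =>
    ¬ (p.1.1.Accepts (p.1.2.word (List.replicate c true)) ↔
      p.1.1.Accepts (p.1.2.word (List.replicate ((c + p.2) % p.1.2.m) true)))) hbase
    (list_range.comp (primrec_m.comp (snd.comp fst)))
  have hall := PrimrecPred.forall_mem_of_list (p := fun (p : DVPACode × NumWitness) d =>
    ¬ 0 < d ∨ ∃ c ∈ List.range p.2.m, ¬ (p.1.Accepts (p.2.word (List.replicate c true)) ↔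
      p.1.Accepts (p.2.word (List.replicate ((c + d) % p.2.m) true))))
    ((nat_lt.comp (.const 0) snd).not.or hex) (list_range.comp (primrec_m.comp snd))
  exact hall.of_eq fun p => by simp only [List.mem_range, imp_iff_not_or]

/-- Every quantifier in the test is bounded, ranging over a list computed from the data. -/
theorem primrecRel_isValid : PrimrecRel fun (D : DVPACode) (K : NumWitness) => K.IsValid D := by
  have hu : ∀ b, Primrec fun p : DVPACode × NumWitness => p.2.u b := fun b =>
    primrec_u.comp snd (.const b)
  have hv : ∀ b, Primrec fun p : DVPACode × NumWitness => p.2.v b := fun b =>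
    primrec_v.comp snd (.const b)
  have hlen : ∀ {f f' : DVPACode × NumWitness → NumWord}, Primrec f → Primrec f' →
      PrimrecPred fun p => (f p).length = (f' p).length :=
    fun h h' => Primrec.eq.comp (list_length.comp h) (list_length.comp h')
  have hwm : ∀ {f : DVPACode × NumWitness → NumWord}, Primrec f →
      PrimrecPred fun p : DVPACode × NumWitness => p.1.IsWellMatched (f p) :=
    fun h => primrecRel_isWellMatched.comp fst h
  exact ((hlen (hu _) (hu _)).and (hlen (hv _) (hv _))).and ((((hwm
    (list_append.comp (hu _) (hv _))).and (hwm (list_append.comp (hu _) (hv _)))).and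
    ((hwm (primrec_x.comp snd)).and (hwm (list_append.comp (primrec_y.comp snd)
      (primrec_z.comp snd))))).and
    ((nat_le.comp (.const 2) (primrec_m.comp snd)).and
      (primrecPred_short.and primrecPred_minimal)))

end Primrec

/-! ### The algorithm -/

open Classical in
/-- The modulus of the numerical data with the given number if these are valid. -/
noncomputable def testWitness (D : DVPACode) (n : ℕ) : Option ℕ :=
  (Encodable.decode (α := NumWitness) n).bind fun K => if K.IsValid D then some K.m else none

theorem mem_testWitness {D : DVPACode} {n m : ℕ} : m ∈ testWitness D n ↔
    ∃ K : NumWitness, Encodable.decode n = some K ∧ K.IsValid D ∧ K.m = m := by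
  simp [testWitness]

open Classical in
theorem primrec_testWitness : Primrec₂ testWitness :=
  Primrec.option_bind (g := fun (p : DVPACode × ℕ) (K : NumWitness) =>
    if K.IsValid p.1 then some K.m else none) (Primrec.decode.comp .snd)
    (Primrec.ite (c := fun s : (DVPACode × ℕ) × NumWitness => s.2.IsValid s.1.1)
      (primrecRel_isValid.comp (Primrec.fst.comp .fst) .snd)
      (Primrec.option_some.comp (primrec_m.comp .snd)) (.const none)).to₂

theorem mainTheorem6 :
    ∃ f : DVPACode →. ℕ, Partrec f ∧
      ∀ (q c i r g : ℕ) (A : DVPA (Fin q) (Fin c) (Fin i) (Fin r) (Fin g)),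
        ¬ (syntacticHom A.language).IsQuasiAperiodic →
        ∃ m ∈ f A.code, 2 ≤ m ∧
          ∀ E : BlockEncoding (Letter (Fin c) (Fin i) (Fin r)),
            CdReducible (modLanguage m) (E.encode A.language) := by
  refine ⟨fun D => Nat.rfindOpt (testWitness D), Partrec.rfindOpt primrec_testWitness.to_comp,
    fun q c i r g A h => ?_⟩
  obtain ⟨_, ⟨W⟩⟩ := exists_modWitness A h
  obtain ⟨K, hK⟩ := W.exists_isValid
  -- Non-quasi-aperiodicity is used only for termination of the search.
  have hdom : (Nat.rfindOpt (testWitness A.code)).Dom := Nat.rfindOpt_dom.mpr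
    ⟨Encodable.encode K, K.m, mem_testWitness.mpr ⟨K, Encodable.encodek K, hK, rfl⟩⟩
  refine ⟨_, Part.get_mem hdom, ?_⟩
  obtain ⟨n, hn⟩ := Nat.rfindOpt_spec (Part.get_mem hdom)
  -- The data found may differ from `K`, but validity alone yields the reduction. The witness lives
  -- on letters, so its modulus serves all encodings.
  obtain ⟨K', -, hK', e⟩ := mem_testWitness.mp hn
  obtain ⟨W'⟩ := hK'.modWitness
  rw [← e]
  exact ⟨W'.two_le, W'.cdReducible⟩
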